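/- Let $n\ge 2$ and consider $\dot x=u(t)+a$ on $[0,\infty)$, where $x(t)\in\mathbb R^n$, the velocity input $u:[0,\infty)\to\mathbb R^n$ is known, the bias $a\in\mathbb R^n$ is constant and unknown, and $y=\tfrac12|x|^2$ is measured. The extended state $X=[x^\top,a^\top,y,a^\top x,|a|^2]^\top\in\mathbb R^{2n+3}$ satisfies $\dot X=A(t)X+\bar u(t)$, $y=CX$, with $\bar u=[u^\top,0_{1\times(n+3)}]^\top$, $$A(t)=\begin{bmatrix}0&I_n&0&0&0\\0&0&0&0&0\\u^\top(t)&0&0&1&0\\0&u^\top(t)&0&0&1\\0&0&0&0&0\end{bmatrix},\qquad C=[\,0_{1\times n}\ 0_{1\times n}\ 1\ 0\ 0\,].$$ Let $\varepsilon>0$, let $k,q:[0,\infty)\to\mathbb R$ be continuous with $k(t)\ge\tfrac12$, $q(t)\ge\varepsilon$ and $q$ bounded, let $V$ be a continuous bounded function on $[0,\infty)$ with values in the symmetric $(2n+3)\times(2n+3)$ matrices and $V(t)\ge\varepsilon I$, and let $P_0$ be symmetric positive definite. The Riccati observer is $$\dot{\hat X}=A(t)\hat X+\bar u(t)+k(t)q(t)P(t)C^\top\,(y-C\hat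 X),\qquad \dot P=A(t)P+PA^\top(t)-q(t)PC^\top CP+V(t),\quad P(0)=P_0,$$ with arbitrary $\hat X(0)\in\mathbb R^{2n+3}$. Suppose that $u$ is bounded and twice differentiable on $[0,\infty)$, with bounded first and second derivatives, and that for some $\delta>0$ and $\mu>0$ $$\frac1\delta\int_t^{t+\delta}\dot u(s)\dot u^\top(s)\,ds\ \ge\ \mu I_n\qquad\text{for all }t\ge 0 .$$ Then the Riccati equation has exactly one solution $P$ on $[0,\infty)$, it is positive definite at all times, for every trajectory $x$ and every $\hat X(0)$ the observer has a solution on $[0,\infty)$, and the observer globally exponentially stabilizes the estimation error $\tilde X:=X-\hat X$ at zero: there are $c,\gamma>0$, independent of $a$, of the trajectory $x$ and of $\hat X(0)$, such that $$|\tilde X(t)|\le c\,e^{-\gamma(t-s)}\,|\tilde X(s)|\qquad\text{for all }t\ge s\ge 0 .$$ -/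

import Mathlib

open scoped Matrix

noncomputable section

namespace RangeObserver

/-- Index set of the `(2n+3)`-dimensional extended state `[x, a, y, aᵀx, |a|²]`. -/
abbrev Idx (n : ℕ) : Type := (Fin n ⊕ Fin n) ⊕ Fin 3

/-- Position, velocity and bias vectors. -/
abbrev Vec (n : ℕ) : Type := EuclideanSpace ℝ (Fin n)

/-- The extended state space, with its Euclidean norm. -/
abbrev State (n : ℕ) : Type := EuclideanSpace ℝ (Idx n)

/-- The state matrix `A`, as a function of the current value `v = u(t)` of the velocity input. -/
def A {n : ℕ} (v : Vec n) : Matrix (Idx n) (Idx n) ℝ :=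
  Matrix.fromBlocks
    (Matrix.fromBlocks 0 1 0 0) 0
    (Matrix.of ![Sum.elim (fun j => v j) 0, Sum.elim 0 (fun j => v j), 0])
    !![0, 1, 0; 0, 0, 1; 0, 0, 0]

/-- The output row `C = [0 0 1 0 0]`. -/
def C (n : ℕ) : Matrix (Fin 1) (Idx n) ℝ :=
  Matrix.fromCols 0 !![1, 0, 0]

/-- The extended input `ū = [uᵀ, 0]ᵀ`, as a function of the current value `v = u(t)`. -/
def ubar {n : ℕ} (v : Vec n) : Idx n → ℝ :=
  Sum.elim (Sum.elim (fun j => v j) 0) 0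

/-- The measured output `y = |x|²/2`. -/
def output {n : ℕ} (x : Vec n) : ℝ := ‖x‖ ^ 2 / 2

/-- The extended state `X = [x, a, y, aᵀx, |a|²]`. -/
def extState {n : ℕ} (x a : Vec n) : State n :=
  WithLp.toLp 2
    (Sum.elim (Sum.elim (fun j => x j) (fun j => a j)) ![output x, inner ℝ a x, ‖a‖ ^ 2])

/-- `x` is a motion on `[0, ∞)` with measured velocity `u` and constant velocity bias `a`:
`ẋ = u + a`. -/
def IsMotion {n : ℕ} (u : ℝ → Vec n) (a : Vec n) (x : ℝ → Vec n) : Prop :=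
  ∀ t, 0 ≤ t → HasDerivWithinAt x (u t + a) (Set.Ici 0) t

/-- The right-hand side `AP + PAᵀ - PCᵀqCP + V` of the continuous Riccati equation. -/
def riccatiRHS {n : ℕ} (v : Vec n) (q : ℝ) (V P : Matrix (Idx n) (Idx n) ℝ) :
    Matrix (Idx n) (Idx n) ℝ :=
  A v * P + P * (A v)ᵀ - q • (P * (C n)ᵀ * C n * P) + V

/-- `P` solves the continuous Riccati equation on `[0, ∞)` with initial value `P₀`
(the derivative of a matrix function being taken entrywise). -/
def IsRiccatiSolution {n : ℕ} (u : ℝ → Vec n) (q : ℝ → ℝ) (V : ℝ → Matrix (Idx n) (Idx n) ℝ)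
    (P₀ : Matrix (Idx n) (Idx n) ℝ) (P : ℝ → Matrix (Idx n) (Idx n) ℝ) : Prop :=
  P 0 = P₀ ∧ ∀ t, 0 ≤ t → ∀ i j,
    HasDerivWithinAt (fun s => P s i j) (riccatiRHS (u t) (q t) (V t) (P t) i j) (Set.Ici 0) t

/-- The observer gain `K = k P Cᵀ q`. -/
def gain {n : ℕ} (k q : ℝ) (P : Matrix (Idx n) (Idx n) ℝ) : Matrix (Idx n) (Fin 1) ℝ :=
  (k * q) • (P * (C n)ᵀ)

/-- `Xh` is a run on `[0, ∞)` of the observer `Ẋh = A Xh + ū + K (y - C Xh)` with gain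
`K = k P Cᵀ q`, fed with the input `u` and with the scalar measurement `y`. -/
def IsObserverRun {n : ℕ} (u : ℝ → Vec n) (k q : ℝ → ℝ) (P : ℝ → Matrix (Idx n) (Idx n) ℝ)
    (y : ℝ → ℝ) (Xh : ℝ → State n) : Prop :=
  ∀ t, 0 ≤ t → HasDerivWithinAt Xh
    (WithLp.toLp 2 (A (u t) *ᵥ (Xh t).ofLp + ubar (u t)
      + gain (k t) (q t) (P t) *ᵥ (![y t] - C n *ᵥ (Xh t).ofLp))) (Set.Ici 0) t

/-- The time derivative of a function on `[0, ∞)` (one-sided at `0`). -/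
def dot {n : ℕ} (f : ℝ → Vec n) : ℝ → Vec n := fun t => derivWithin f (Set.Ici 0) t

/-- The matrix `(1/δ) ∫_t^{t+δ} w(s) w(s)ᵀ ds`. -/
def excitation {n : ℕ} (w : ℝ → Vec n) (δ t : ℝ) : Matrix (Fin n) (Fin n) ℝ :=
  Matrix.of fun i j => (1 / δ) * ∫ s in t..(t + δ), w s i * w s j

/-- The persistent excitation condition with window `δ` and level `μ`:
`(1/δ) ∫_t^{t+δ} w wᵀ ds ≥ μ I` for all `t ≥ 0`, in the order of symmetric matrices. -/
def PersistentlyExciting {n : ℕ} (w : ℝ → Vec n) (δ μ : ℝ) : Prop :=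
  ∀ t, 0 ≤ t → (excitation w δ t - μ • (1 : Matrix (Fin n) (Fin n) ℝ)).PosSemidef

/-- The observer with gain built from `k`, `q`, `P` globally exponentially stabilizes the
estimation error `X - Xh` at zero, uniformly in the motion, the bias, the initial estimate and the
initial time `s`. -/
def GloballyExponentiallyStabilizes {n : ℕ} (u : ℝ → Vec n) (k q : ℝ → ℝ)
    (P : ℝ → Matrix (Idx n) (Idx n) ℝ) : Prop :=
  ∃ c γ : ℝ, 0 < c ∧ 0 < γ ∧
    ∀ (a : Vec n) (x : ℝ → Vec n), IsMotion u a x →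
      ∀ Xh : ℝ → State n, IsObserverRun u k q P (fun t => output (x t)) Xh →
        ∀ s t, 0 ≤ s → s ≤ t →
          ‖extState (x t) a - Xh t‖ ≤ c * Real.exp (-γ * (t - s)) * ‖extState (x s) a - Xh s‖

end RangeObserver

end

/-!
The error `e = X - X̂` obeys the linear equation `ė = (A - k q P Cᵀ C) e`, and `2 k ≥ 1` makes
`⟨e, P⁻¹ e⟩` decrease at least at the rate `⟨P⁻¹ e, V P⁻¹ e⟩ ≥ ε |P⁻¹ e|²`
(`IsHamiltonianPair.deriv_lyapunov`). Exponential stability follows once `P` and `P⁻¹` are bounded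
uniformly in time.

Existence, uniqueness and positivity for the Riccati equation come from the Hamiltonian linear
system `Ẏ = A Y + V Z`, `Ż = -Aᵀ Z + q Cᵀ C Y` with `Y(0) = P₀`, `Z(0) = 1`, whose solutions exist
for all times. Along it the form `⟨Y η, Z η⟩` has derivative `q |C Y η|² + ⟨V Z η, Z η⟩ ≥ 0` and
starts at `⟨P₀ η, η⟩`, so that `Y` and `Z` stay invertible and `P = Y Z⁻¹` is a global positive
definite solution; for any other solution `P'`, the difference `P' Z - Y` solves a linear equation
with initial value zero (`IsHamiltonianPair.eq_riccatiOf`).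

The same identity gives the bounds. The curve `Y η` is a trajectory of `ẋ = A x` perturbed by
`V Z η`, and the growth of `⟨Y η, Z η⟩` over a window dominates the energies of its output and of
the perturbation. Uniform observability of `(A, C)` therefore yields `|Y η|² ≤ K ⟨Y η, Z η⟩`, which
bounds `P` (`IsHamiltonianPair.exists_sq_norm_fst_le`). The analogous estimate for `Z η`, where the
whole state is controlled and no observability is needed, bounds `P⁻¹`
(`IsHamiltonianPair.exists_sq_norm_snd_le`).

Uniform observability may fail on short windows. Without perturbation, the bias component `a` and
the last component `w` of the extended state are constants, and the others satisfy `ṗ = a`,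
`ẏ = uᵀp + z` and `ż = uᵀa + w`, so that `ÿ = u̇ᵀp + 2 uᵀa + w`. A small output on the window has
small `ẏ` and `ÿ`, as the third derivative is bounded. Persistent excitation, applied at the end of the
window where `|p|` is largest, then gives `√μ max |p| ≲ |w| + |a|`, while the increment of
`z = ẏ - uᵀp` over a window of length `L` gives `L |w| ≲ max |p| + L |a|`, and `L |a| ≤ 2 max |p|`
because `p` moves with velocity `a`. For large `L` the three estimates force `p`, `a`, `w` and `z` to be
small (`IsFreeTrajectory.bounds_of_small_derivs`); by homogeneity this is a quantitative
observability estimate (`IsExcitingInput.exists_observability`), and Grönwall's inequality adds the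
perturbation (`isUniformlyObservable_of_free`).
-/

/-! ### Global solutions of time-dependent differential equations -/

namespace RangeObserver

section ODE

open Set Metric
open scoped NNReal

variable {F : Type*} [NormedAddCommGroup F] [NormedSpace ℝ F]

/-- The radial retraction of a normed space onto the closed ball of radius `R` about the origin. -/
noncomputable def radialRetraction (R : ℝ) (x : F) : F := (R / max R ‖x‖) • x

theorem radialRetraction_of_norm_le {R : ℝ} (hR : 0 < R) {x : F} (hx : ‖x‖ ≤ R) :
    radialRetraction R x = x := by
  rw [radialRetraction, max_eq_left hx, div_self hR.ne', one_smul]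

theorem norm_radialRetraction_le_norm {R : ℝ} (hR : 0 < R) (x : F) :
    ‖radialRetraction R x‖ ≤ ‖x‖ := by
  have hm : 0 < max R ‖x‖ := lt_max_of_lt_left hR
  rw [radialRetraction, norm_smul, Real.norm_of_nonneg (by positivity)]
  exact mul_le_of_le_one_left (norm_nonneg _) ((div_le_one hm).2 (le_max_left _ _))

theorem norm_radialRetraction_le {R : ℝ} (hR : 0 < R) (x : F) :
    ‖radialRetraction R x‖ ≤ R := by
  have hm : 0 < max R ‖x‖ := lt_max_of_lt_left hR
  rw [radialRetraction, norm_smul, Real.norm_of_nonneg (by positivity), div_mul_eq_mul_div,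
    div_le_iff₀ hm]
  exact mul_le_mul_of_nonneg_left (le_max_right _ _) hR.le

theorem lipschitzWith_radialRetraction {R : ℝ} (hR : 0 < R) :
    LipschitzWith 2 (radialRetraction R : F → F) := by
  refine LipschitzWith.of_dist_le_mul fun x y => ?_
  have hx : 0 < max R ‖x‖ := lt_max_of_lt_left hR
  have hy : 0 < max R ‖y‖ := lt_max_of_lt_left hR
  have hsplit : radialRetraction R x - radialRetraction R y
      = (R / max R ‖x‖) • (x - y) + (R / max R ‖x‖ - R / max R ‖y‖) • y := by
    simp only [radialRetraction, smul_sub, sub_smul]; abel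
  have h1 : ‖(R / max R ‖x‖) • (x - y)‖ ≤ ‖x - y‖ := by
    rw [norm_smul, Real.norm_of_nonneg (by positivity)]
    exact mul_le_of_le_one_left (norm_nonneg _) ((div_le_one hx).2 (le_max_left _ _))
  have h2 : ‖(R / max R ‖x‖ - R / max R ‖y‖) • y‖ ≤ ‖x - y‖ := by
    have hd : R / max R ‖x‖ - R / max R ‖y‖
        = (R / max R ‖x‖) * ((max R ‖y‖ - max R ‖x‖) / max R ‖y‖) := by
      field_simp
    have hm : |max R ‖y‖ - max R ‖x‖| ≤ ‖x - y‖ := by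
      have := abs_max_sub_max_le_max R ‖y‖ R ‖x‖
      rw [sub_self, abs_zero, max_eq_right (abs_nonneg (‖y‖ - ‖x‖))] at this
      exact this.trans ((abs_norm_sub_norm_le _ _).trans_eq (norm_sub_rev _ _))
    rw [norm_smul, hd, Real.norm_eq_abs, abs_mul,
      abs_of_nonneg (by positivity : 0 ≤ R / max R ‖x‖), abs_div, abs_of_pos hy]
    calc R / max R ‖x‖ * (|max R ‖y‖ - max R ‖x‖| / max R ‖y‖) * ‖y‖
        = (R / max R ‖x‖) * |max R ‖y‖ - max R ‖x‖| * (‖y‖ / max R ‖y‖) := by ring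
      _ ≤ 1 * ‖x - y‖ * 1 := by
        gcongr
        · exact (div_le_one hx).2 (le_max_left _ _)
        · exact (div_le_one hy).2 (le_max_right _ _)
      _ = ‖x - y‖ := by ring
  rw [dist_eq_norm, dist_eq_norm, hsplit]
  calc _ ≤ ‖x - y‖ + ‖x - y‖ := (norm_add_le _ _).trans (add_le_add h1 h2)
    _ = _ := by push_cast; ring

/-- A vector field that is Lipschitz in the state, with the same constant on all of `[t₀, T]`, has
a solution on `[t₀, T]`. Grönwall's inequality bounds the solutions a priori, so the field may be
truncated outside a large ball, and then the Picard-Lindelöf theorem applies on the whole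
interval. -/
theorem exists_solution_Icc [CompleteSpace F] {f : ℝ → F → F} {t₀ T : ℝ} (hT : t₀ ≤ T) {K : ℝ≥0}
    (hc : ∀ x, ContinuousOn (fun t => f t x) (Icc t₀ T))
    (hL : ∀ t ∈ Icc t₀ T, LipschitzWith K (f t)) (x₀ : F) :
    ∃ α : ℝ → F, α t₀ = x₀ ∧ ∀ t ∈ Icc t₀ T, HasDerivWithinAt α (f t (α t)) (Icc t₀ T) t := by
  obtain ⟨b, hb⟩ := isCompact_Icc.exists_bound_of_continuousOn (hc 0)
  have hb0 : 0 ≤ b := (norm_nonneg _).trans (hb t₀ ⟨le_rfl, hT⟩)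
  have hgrow : ∀ t ∈ Icc t₀ T, ∀ x, ‖f t x‖ ≤ K * ‖x‖ + b := fun t ht x => by
    have h1 := (hL t ht).dist_le_mul x 0
    rw [dist_eq_norm, dist_zero_right] at h1
    calc ‖f t x‖ = ‖(f t x - f t 0) + f t 0‖ := by rw [sub_add_cancel]
      _ ≤ _ := (norm_add_le _ _).trans (add_le_add h1 (hb t ht))
  set R : ℝ := gronwallBound ‖x₀‖ K b (T - t₀) + 1 with hRdef
  have hmono := gronwallBound_mono (norm_nonneg x₀) hb0 K.coe_nonneg
  have hR : 0 < R := by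
    have := hmono (sub_nonneg.2 hT)
    rw [gronwallBound_x0] at this
    have := norm_nonneg x₀
    linarith
  let B : ℝ≥0 := ⟨K * R + b, by positivity⟩
  have hPL : IsPicardLindelof (fun t x => f t (radialRetraction R x))
      (⟨t₀, left_mem_Icc.2 hT⟩ : Icc t₀ T) x₀ (B * ⟨T - t₀, sub_nonneg.2 hT⟩) 0 B (K * 2) := by
    refine ⟨fun t ht => ?_, fun x _ => hc _, fun t ht x _ => ?_, ?_⟩
    · exact ((hL t ht).comp (lipschitzWith_radialRetraction hR)).lipschitzOnWith
    · refine (hgrow t ht _).trans ?_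
      change _ ≤ K * R + b
      gcongr
      exact norm_radialRetraction_le hR x
    · rw [max_eq_left (by simpa using hT), NNReal.coe_zero, sub_zero]
      exact le_rfl
  obtain ⟨α, hα0, hα⟩ := hPL.exists_eq_forall_mem_Icc_hasDerivWithinAt₀
  have hbound : ∀ t ∈ Icc t₀ T, ‖α t‖ ≤ R := fun t ht => by
    have := norm_le_gronwallBound_of_norm_deriv_right_le (f := α) (δ := ‖x₀‖) (K := K) (ε := b)
      (fun t ht => (hα t ht).continuousWithinAt)
      (fun t ht => (hα t (Ico_subset_Icc_self ht)).mono_of_mem_nhdsWithin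
        (Icc_mem_nhdsGE_of_mem ht)) (by rw [← hα0])
      (fun t ht => (hgrow t (Ico_subset_Icc_self ht) _).trans (by
        gcongr; exact norm_radialRetraction_le_norm hR _)) t ht
    have h2 := hmono (sub_le_sub_right ht.2 t₀)
    linarith
  refine ⟨α, hα0, fun t ht => ?_⟩
  have := hα t ht
  rwa [radialRetraction_of_norm_le hR (hbound t ht)] at this

/-- A vector field that is Lipschitz in the state, locally uniformly in time, has a solution on
`[t₀, ∞)` for every initial value. -/
theorem exists_solution_Ici [CompleteSpace F] {f : ℝ → F → F} {t₀ : ℝ}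
    (hc : ∀ x, ContinuousOn (fun t => f t x) (Ici t₀))
    (hL : ∀ T, ∃ K : ℝ≥0, ∀ t ∈ Icc t₀ T, LipschitzWith K (f t)) (x₀ : F) :
    ∃ α : ℝ → F, α t₀ = x₀ ∧ ∀ t ∈ Ici t₀, HasDerivWithinAt α (f t (α t)) (Ici t₀) t := by
  have hex : ∀ N : ℕ, ∃ α : ℝ → F, α t₀ = x₀ ∧ ∀ t ∈ Icc t₀ (t₀ + N),
      HasDerivWithinAt α (f t (α t)) (Icc t₀ (t₀ + N)) t := fun N => by
    obtain ⟨K, hK⟩ := hL (t₀ + N)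
    exact exists_solution_Icc (by simp) (fun x => (hc x).mono Icc_subset_Ici_self) hK x₀
  choose α hα0 hα using hex
  have hagree : ∀ N M : ℕ, N ≤ M → EqOn (α N) (α M) (Icc t₀ (t₀ + N)) := fun N M hNM => by
    obtain ⟨K, hK⟩ := hL (t₀ + N)
    have hsub : Icc t₀ (t₀ + N) ⊆ Icc t₀ (t₀ + (M : ℝ)) :=
      Icc_subset_Icc_right (by gcongr)
    refine ODE_solution_unique_of_mem_Icc_right (v := f) (s := fun _ => univ) (K := K)
      (fun t ht => (hK t (Ico_subset_Icc_self ht)).lipschitzOnWith)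
      (fun t ht => (hα N t ht).continuousWithinAt)
      (fun t ht => (hα N t (Ico_subset_Icc_self ht)).mono_of_mem_nhdsWithin
        (Icc_mem_nhdsGE_of_mem ht)) (fun _ _ => trivial)
      (fun t ht => ((hα M t (hsub ht)).mono hsub).continuousWithinAt)
      (fun t ht => ((hα M t (hsub (Ico_subset_Icc_self ht))).mono hsub).mono_of_mem_nhdsWithin
        (Icc_mem_nhdsGE_of_mem ht)) (fun _ _ => trivial) (by rw [hα0, hα0])
  let β : ℝ → F := fun t => α ⌈t - t₀⌉₊ t
  have hβ : ∀ N : ℕ, EqOn β (α N) (Icc t₀ (t₀ + N)) := fun N t ht => by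
    have h1 : ⌈t - t₀⌉₊ ≤ N := Nat.ceil_le.2 (by linarith [ht.2])
    exact hagree _ _ h1 ⟨ht.1, by linarith [Nat.le_ceil (t - t₀)]⟩
  refine ⟨β, by rw [hβ 0 ⟨le_rfl, by simp⟩, hα0], fun t ht => ?_⟩
  obtain ⟨N, hN⟩ := exists_nat_gt (t - t₀)
  have htN : t ∈ Icc t₀ (t₀ + N) := ⟨ht, by linarith⟩
  have hmem : Icc t₀ (t₀ + (N : ℝ)) ∈ nhdsWithin t (Ici t₀) := by
    rw [← Ici_inter_Iic]
    exact Filter.inter_mem self_mem_nhdsWithin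
      (mem_nhdsWithin_of_mem_nhds (Iic_mem_nhds (by linarith)))
  have h := ((hα N t htN).congr (hβ N) (hβ N htN)).mono_of_mem_nhdsWithin hmem
  rwa [← hβ N htN] at h

/-- Uniqueness for linear equations: a function on `[0, ∞)` that starts at zero, and whose
derivative is bounded by a continuous multiple of its norm, vanishes. -/
theorem eq_zero_of_linear_ode {f : ℝ → F} {f' : ℝ → F} {β : ℝ → ℝ}
    (hβ : ContinuousOn β (Ici 0)) (hf : ∀ t ∈ Ici (0 : ℝ), HasDerivWithinAt f (f' t) (Ici 0) t)
    (hle : ∀ t ∈ Ici (0 : ℝ), ‖f' t‖ ≤ β t * ‖f t‖) (h0 : f 0 = 0) {t : ℝ} (ht : 0 ≤ t) :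
    f t = 0 := by
  obtain ⟨b, hb⟩ := isCompact_Icc.exists_bound_of_continuousOn
    (hβ.mono (Icc_subset_Ici_self : Icc 0 t ⊆ Ici 0))
  refine eq_zero_of_abs_deriv_le_mul_abs_self_of_eq_zero_right (f' := f') (K := b) (b := t)
    (fun s hs => ((hf s hs.1).mono Icc_subset_Ici_self).continuousWithinAt)
    (fun s hs => (hf s hs.1).mono (Ici_subset_Ici.2 hs.1)) h0 (fun s hs => ?_) t ⟨ht, le_rfl⟩
  refine (hle s hs.1).trans ?_
  gcongr
  exact (le_abs_self _).trans (hb s (Ico_subset_Icc_self hs))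

end ODE

end RangeObserver

/-! ### The Riccati equation through its Hamiltonian linear system -/

namespace RangeObserver

section Riccati

open Set ContinuousLinearMap InnerProductSpace
open scoped NNReal RealInnerProductSpace

theorem le_of_hasDerivWithinAt_nonneg {f f' : ℝ → ℝ} {a b : ℝ} (hab : a ≤ b)
    (hf : ∀ t ∈ Icc a b, HasDerivWithinAt f (f' t) (Icc a b) t)
    (hf' : ∀ t ∈ Icc a b, 0 ≤ f' t) : f a ≤ f b :=
  monotoneOn_of_hasDerivWithinAt_nonneg (convex_Icc a b)
    (fun t ht => (hf t ht).continuousWithinAt)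
    (fun t ht => (hf t (interior_subset ht)).mono interior_subset)
    (fun t ht => hf' t (interior_subset ht)) ⟨le_rfl, hab⟩ ⟨hab, le_rfl⟩ hab

theorem hasDerivWithinAt_mul_ringInverse {R : Type*} [NormedRing R] [NormedAlgebra ℝ R]
    [CompleteSpace R] {X W : ℝ → R} {X' W' : R} {s : Set ℝ} {t : ℝ}
    (hX : HasDerivWithinAt X X' s t) (hW : HasDerivWithinAt W W' s t) (hu : IsUnit (W t)) :
    HasDerivWithinAt (fun r => X r * Ring.inverse (W r))
      (X' * Ring.inverse (W t)
        - X t * (Ring.inverse (W t) * W' * Ring.inverse (W t))) s t := by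
  obtain ⟨w, hw⟩ := hu
  have h1 := hasFDerivAt_ringInverse (𝕜 := ℝ) w
  rw [hw] at h1
  have h2 := hX.mul (h1.comp_hasDerivWithinAt t hW)
  refine h2.congr_deriv ?_
  simp [sub_eq_add_neg, ← hw]

variable {E : Type*} [NormedAddCommGroup E] [InnerProductSpace ℝ E] [FiniteDimensional ℝ E]

/-- The Hamiltonian linear system `Ẏ = A Y + V Z`, `Ż = -Aᵀ Z + Q Y`, with `Q = q c cᵀ`, attached
to the Riccati equation `Ṗ = A P + P Aᵀ - P Q P + V`, with `Y(0) = P₀` and `Z(0) = 1`. -/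
structure IsHamiltonianPair (A V : ℝ → E →L[ℝ] E) (q : ℝ → ℝ) (c : E) (P₀ : E →L[ℝ] E)
    (Y Z : ℝ → E →L[ℝ] E) : Prop where
  init_fst : Y 0 = P₀
  init_snd : Z 0 = 1
  deriv_fst : ∀ t ∈ Ici (0 : ℝ), HasDerivWithinAt Y (A t * Y t + V t * Z t) (Ici 0) t
  deriv_snd : ∀ t ∈ Ici (0 : ℝ),
    HasDerivWithinAt Z (-(adjoint (A t) * Z t) + q t • rankOne ℝ c c * Y t) (Ici 0) t

/-- The coefficients of the Riccati equation are continuous on `[0, ∞)`, the output weight `q` is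
at least `ε`, and `V` is symmetric with `V ≥ ε I`. -/
structure IsRiccatiData (A V : ℝ → E →L[ℝ] E) (q : ℝ → ℝ) (ε : ℝ) : Prop where
  pos : 0 < ε
  cont_A : ContinuousOn A (Ici 0)
  cont_V : ContinuousOn V (Ici 0)
  cont_q : ContinuousOn q (Ici 0)
  le_q : ∀ t ∈ Ici (0 : ℝ), ε ≤ q t
  symm_V : ∀ t ∈ Ici (0 : ℝ), ∀ x y, ⟪V t x, y⟫ = ⟪x, V t y⟫
  le_V : ∀ t ∈ Ici (0 : ℝ), ∀ x, ε * ‖x‖ ^ 2 ≤ ⟪V t x, x⟫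

variable {A V : ℝ → E →L[ℝ] E} {q : ℝ → ℝ} {ε p₀ : ℝ} {c : E} {P₀ : E →L[ℝ] E}
  {Y Z : ℝ → E →L[ℝ] E}

theorem IsRiccatiData.exists_hamiltonianPair (h : IsRiccatiData A V q ε) (c : E)
    (P₀ : E →L[ℝ] E) : ∃ Y Z, IsHamiltonianPair A V q c P₀ Y Z := by
  have hA' : ContinuousOn (fun t => adjoint (A t)) (Ici 0) :=
    (adjoint (𝕜 := ℝ) (E := E) (F := E)).continuous.comp_continuousOn h.cont_A
  have hQ : ContinuousOn (fun t => q t • rankOne ℝ c c) (Ici 0) :=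
    h.cont_q.smul continuousOn_const
  let f : ℝ → (E →L[ℝ] E) × (E →L[ℝ] E) → (E →L[ℝ] E) × (E →L[ℝ] E) := fun t W =>
    (A t * W.1 + V t * W.2, -(adjoint (A t) * W.2) + q t • rankOne ℝ c c * W.1)
  obtain ⟨W, hW0, hW⟩ := exists_solution_Ici (f := f) (t₀ := 0) (x₀ := (P₀, 1))
    (fun W => ((h.cont_A.mul continuousOn_const).add (h.cont_V.mul continuousOn_const)).prodMk
      ((hA'.mul continuousOn_const).neg.add (hQ.mul continuousOn_const)))
    (fun T => by
      have hsub : Icc (0 : ℝ) T ⊆ Ici 0 := Icc_subset_Ici_self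
      obtain ⟨a, ha⟩ := isCompact_Icc.exists_bound_of_continuousOn (h.cont_A.mono hsub)
      obtain ⟨v, hv⟩ := isCompact_Icc.exists_bound_of_continuousOn (h.cont_V.mono hsub)
      obtain ⟨b, hb⟩ := isCompact_Icc.exists_bound_of_continuousOn (hQ.mono hsub)
      refine ⟨(|a| + |v| + |b|).toNNReal, fun t ht => LipschitzWith.of_dist_le_mul fun x y => ?_⟩
      have ha' := (ha t ht).trans (le_abs_self a)
      have hv' := (hv t ht).trans (le_abs_self v)
      have hb' := (hb t ht).trans (le_abs_self b)
      have h1 : ‖x.1 - y.1‖ ≤ ‖x - y‖ := norm_fst_le (x - y)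
      have h2 : ‖x.2 - y.2‖ ≤ ‖x - y‖ := norm_snd_le (x - y)
      have hd := norm_nonneg (x - y)
      rw [dist_eq_norm, dist_eq_norm, Real.coe_toNNReal _ (by positivity)]
      refine max_le ?_ ?_
      · have : (f t x - f t y).1 = A t * (x.1 - y.1) + V t * (x.2 - y.2) := by
          simp only [f, Prod.fst_sub, mul_sub]; abel
        rw [this]
        calc _ ≤ |a| * ‖x - y‖ + |v| * ‖x - y‖ := (norm_add_le _ _).trans (add_le_add
              ((norm_mul_le _ _).trans (by gcongr)) ((norm_mul_le _ _).trans (by gcongr)))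
          _ ≤ _ := by nlinarith [mul_nonneg (abs_nonneg b) hd]
      · have : (f t x - f t y).2 = -(adjoint (A t) * (x.2 - y.2))
            + q t • rankOne ℝ c c * (x.1 - y.1) := by
          simp only [f, Prod.snd_sub, mul_sub]; abel
        rw [this]
        calc _ ≤ |a| * ‖x - y‖ + |b| * ‖x - y‖ := (norm_add_le _ _).trans (add_le_add
              (by
                rw [norm_neg]
                refine (norm_mul_le _ _).trans ?_
                rw [LinearIsometryEquiv.norm_map]
                gcongr) ((norm_mul_le _ _).trans (by gcongr)))
          _ ≤ _ := by nlinarith [mul_nonneg (abs_nonneg v) hd])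
  exact ⟨fun t => (W t).1, fun t => (W t).2, by rw [hW0], by rw [hW0],
    fun t ht => (ContinuousLinearMap.fst ℝ (E →L[ℝ] E)
      (E →L[ℝ] E)).hasFDerivAt.comp_hasDerivWithinAt t (hW t ht),
    fun t ht => (ContinuousLinearMap.snd ℝ (E →L[ℝ] E)
      (E →L[ℝ] E)).hasFDerivAt.comp_hasDerivWithinAt t (hW t ht)⟩

theorem isUnit_of_forall_ne_zero {T : E →L[ℝ] E} (hT : ∀ x, x ≠ 0 → T x ≠ 0) : IsUnit T := by
  have hinj : Function.Injective T :=
    (injective_iff_map_eq_zero T).2 fun x hx => by_contra fun h0 => hT x h0 hx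
  exact isUnit_iff_bijective.2 ⟨hinj, LinearMap.injective_iff_surjective.1 hinj⟩

namespace IsHamiltonianPair

theorem deriv_fst_apply (h : IsHamiltonianPair A V q c P₀ Y Z) (η : E) {t : ℝ} (ht : 0 ≤ t) :
    HasDerivWithinAt (fun s => Y s η) (A t (Y t η) + V t (Z t η)) (Ici 0) t := by
  simpa using (h.deriv_fst t ht).clm_apply (hasDerivWithinAt_const t (Ici 0) η)

theorem deriv_snd_apply (h : IsHamiltonianPair A V q c P₀ Y Z) (η : E) {t : ℝ} (ht : 0 ≤ t) :
    HasDerivWithinAt (fun s => Z s η)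
      (-(adjoint (A t) (Z t η)) + (q t * ⟪c, Y t η⟫) • c) (Ici 0) t := by
  simpa [mul_smul] using (h.deriv_snd t ht).clm_apply (hasDerivWithinAt_const t (Ici 0) η)

/-- The bilinear form `⟨Y η, Z ξ⟩` is symmetric because the Hamiltonian flow is symplectic. -/
theorem inner_comm (h : IsHamiltonianPair A V q c P₀ Y Z) (hd : IsRiccatiData A V q ε)
    (hP₀ : ∀ x y, ⟪P₀ x, y⟫ = ⟪x, P₀ y⟫) (η ξ : E) {t : ℝ} (ht : 0 ≤ t) :
    ⟪Y t η, Z t ξ⟫ = ⟪Z t η, Y t ξ⟫ := by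
  have hder : ∀ s ∈ Ici (0 : ℝ),
      HasDerivWithinAt (fun s => ⟪Y s η, Z s ξ⟫ - ⟪Z s η, Y s ξ⟫) 0 (Ici 0) s := fun s hs => by
    refine (((h.deriv_fst_apply η hs).inner ℝ (h.deriv_snd_apply ξ hs)).sub
      ((h.deriv_snd_apply η hs).inner ℝ (h.deriv_fst_apply ξ hs))).congr_deriv ?_
    simp only [inner_add_left, inner_add_right, inner_neg_left, inner_neg_right,
      adjoint_inner_left, adjoint_inner_right, inner_smul_left, inner_smul_right,
      hd.symm_V s hs, real_inner_comm c]
    simp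
    ring
  have := eq_zero_of_linear_ode (β := 0) continuousOn_const hder (by simp)
    (by simp [h.init_fst, h.init_snd, hP₀]) ht
  exact sub_eq_zero.1 this

theorem deriv_inner (h : IsHamiltonianPair A V q c P₀ Y Z) (η : E) {t : ℝ} (ht : 0 ≤ t) :
    HasDerivWithinAt (fun s => ⟪Y s η, Z s η⟫)
      (q t * ⟪c, Y t η⟫ ^ 2 + ⟪V t (Z t η), Z t η⟫) (Ici 0) t := by
  refine ((h.deriv_fst_apply η ht).inner ℝ (h.deriv_snd_apply η ht)).congr_deriv ?_
  simp only [inner_add_left, inner_add_right, inner_neg_right, adjoint_inner_right,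
    inner_smul_right, real_inner_comm c]
  ring

theorem inner_init_le (h : IsHamiltonianPair A V q c P₀ Y Z) (hd : IsRiccatiData A V q ε)
    (η : E) {t : ℝ} (ht : 0 ≤ t) : ⟪P₀ η, η⟫ ≤ ⟪Y t η, Z t η⟫ := by
  have := le_of_hasDerivWithinAt_nonneg ht
    (fun s hs => (h.deriv_inner η hs.1).mono Icc_subset_Ici_self) (fun s hs => by
      have h1 := hd.pos.le.trans (hd.le_q s hs.1)
      have h2 := hd.le_V s hs.1 (Z s η)
      have h3 : 0 ≤ ε * ‖Z s η‖ ^ 2 := mul_nonneg hd.pos.le (sq_nonneg _)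
      exact add_nonneg (mul_nonneg h1 (sq_nonneg _)) (h3.trans h2))
  simpa [h.init_fst, h.init_snd] using this

theorem inner_pos (h : IsHamiltonianPair A V q c P₀ Y Z) (hd : IsRiccatiData A V q ε)
    (hp₀ : 0 < p₀) (hP₀ : ∀ x, p₀ * ‖x‖ ^ 2 ≤ ⟪P₀ x, x⟫) {η : E} (hη : η ≠ 0) {t : ℝ}
    (ht : 0 ≤ t) : 0 < ⟪Y t η, Z t η⟫ :=
  (mul_pos hp₀ (pow_pos (norm_pos_iff.2 hη) 2)).trans_le
    ((hP₀ η).trans (h.inner_init_le hd η ht))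

theorem isUnit_fst (h : IsHamiltonianPair A V q c P₀ Y Z) (hd : IsRiccatiData A V q ε)
    (hp₀ : 0 < p₀) (hP₀ : ∀ x, p₀ * ‖x‖ ^ 2 ≤ ⟪P₀ x, x⟫) {t : ℝ} (ht : 0 ≤ t) :
    IsUnit (Y t) := by
  refine isUnit_of_forall_ne_zero fun η hη h0 => ?_
  have := h.inner_pos hd hp₀ hP₀ hη ht
  rw [h0, inner_zero_left] at this
  exact this.false

theorem isUnit_snd (h : IsHamiltonianPair A V q c P₀ Y Z) (hd : IsRiccatiData A V q ε)
    (hp₀ : 0 < p₀) (hP₀ : ∀ x, p₀ * ‖x‖ ^ 2 ≤ ⟪P₀ x, x⟫) {t : ℝ} (ht : 0 ≤ t) :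
    IsUnit (Z t) := by
  refine isUnit_of_forall_ne_zero fun η hη h0 => ?_
  have := h.inner_pos hd hp₀ hP₀ hη ht
  rw [h0, inner_zero_right] at this
  exact this.false

end IsHamiltonianPair

/-- The solution `P = Y Z⁻¹` of the Riccati equation defined by a Hamiltonian pair. -/
noncomputable def riccatiOf (Y Z : ℝ → E →L[ℝ] E) (t : ℝ) : E →L[ℝ] E := Y t * Ring.inverse (Z t)

/-- The inverse `M = Z Y⁻¹` of `riccatiOf Y Z`. -/
noncomputable def informationOf (Y Z : ℝ → E →L[ℝ] E) (t : ℝ) : E →L[ℝ] E :=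
  Z t * Ring.inverse (Y t)

namespace IsHamiltonianPair

theorem hasDerivWithinAt_riccatiOf (h : IsHamiltonianPair A V q c P₀ Y Z) {t : ℝ} (ht : 0 ≤ t)
    (hZ : IsUnit (Z t)) :
    HasDerivWithinAt (riccatiOf Y Z) (A t * riccatiOf Y Z t + riccatiOf Y Z t * adjoint (A t)
      - riccatiOf Y Z t * (q t • rankOne ℝ c c) * riccatiOf Y Z t + V t) (Ici 0) t := by
  refine (hasDerivWithinAt_mul_ringInverse (h.deriv_fst t ht) (h.deriv_snd t ht) hZ).congr_deriv ?_
  have h1 := Ring.mul_inverse_cancel _ hZ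
  simp only [riccatiOf, add_mul, mul_add, neg_mul, mul_neg, mul_assoc, h1, mul_one]
  abel

theorem hasDerivWithinAt_informationOf (h : IsHamiltonianPair A V q c P₀ Y Z) {t : ℝ}
    (ht : 0 ≤ t) (hY : IsUnit (Y t)) :
    HasDerivWithinAt (informationOf Y Z) (-(adjoint (A t) * informationOf Y Z t)
      - informationOf Y Z t * A t + q t • rankOne ℝ c c
      - informationOf Y Z t * V t * informationOf Y Z t) (Ici 0) t := by
  refine (hasDerivWithinAt_mul_ringInverse (h.deriv_snd t ht) (h.deriv_fst t ht) hY).congr_deriv ?_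
  have h1 := Ring.mul_inverse_cancel _ hY
  simp only [informationOf, add_mul, mul_add, neg_mul, mul_assoc, h1, mul_one]
  abel

/-- The Riccati equation has at most one solution: for a solution `P'`, the difference `P' Z - Y`
solves a linear equation and starts at zero. -/
theorem eq_riccatiOf (h : IsHamiltonianPair A V q c P₀ Y Z) (hd : IsRiccatiData A V q ε)
    {P : ℝ → E →L[ℝ] E} (hP0 : P 0 = P₀)
    (hP : ∀ t ∈ Ici (0 : ℝ), HasDerivWithinAt P (A t * P t + P t * adjoint (A t)
      - P t * (q t • rankOne ℝ c c) * P t + V t) (Ici 0) t) {t : ℝ} (ht : 0 ≤ t)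
    (hZ : IsUnit (Z t)) : P t = riccatiOf Y Z t := by
  have hPc : ContinuousOn P (Ici 0) := fun t ht => (hP t ht).continuousWithinAt
  have hβ : ContinuousOn (fun t => ‖A t - P t * (q t • rankOne ℝ c c)‖) (Ici 0) :=
    (hd.cont_A.sub (hPc.mul (hd.cont_q.smul continuousOn_const))).norm
  have h0 : P t * Z t - Y t = 0 := by
    refine eq_zero_of_linear_ode (f := fun s => P s * Z s - Y s)
      (f' := fun s => (A s - P s * (q s • rankOne ℝ c c)) * (P s * Z s - Y s)) hβ
      (fun s hs => ?_) (fun s _ => norm_mul_le _ _) (by simp [hP0, h.init_fst, h.init_snd]) ht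
    refine (((hP s hs).mul (h.deriv_snd s hs)).sub (h.deriv_fst s hs)).congr_deriv ?_
    simp only [add_mul, sub_mul, mul_add, mul_sub, mul_neg, mul_assoc]
    abel
  rw [riccatiOf, ← sub_eq_zero.1 h0, mul_assoc, Ring.mul_inverse_cancel _ hZ, mul_one]

end IsHamiltonianPair

end Riccati

end RangeObserver

/-! ### Uniform bounds and exponential stability -/

namespace RangeObserver

section Stability

open Set ContinuousLinearMap InnerProductSpace
open scoped NNReal RealInnerProductSpace

variable {E : Type*} [NormedAddCommGroup E] [InnerProductSpace ℝ E] [FiniteDimensional ℝ E]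

/-- Uniform observability of the pair `(A, c)`: there is a window length `L` such that the final
state of a perturbed trajectory `ẋ = A x + g` on any window of length `L` in `[0, ∞)` is controlled
by the energies of the output `⟨c, x⟩` and of the perturbation `g`. Integrals are avoided: the
energy is measured by the increment of any function `Φ` with `Φ' ≥ ⟨c, x⟩² + |g|²`. -/
def IsUniformlyObservable (A : ℝ → E →L[ℝ] E) (c : E) : Prop :=
  ∃ L K : ℝ, 0 < L ∧ 0 ≤ K ∧ ∀ (t₀ : ℝ) (x g : ℝ → E) (Φ Φ' : ℝ → ℝ), 0 ≤ t₀ →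
    (∀ t ∈ Icc t₀ (t₀ + L), HasDerivWithinAt x (A t (x t) + g t) (Icc t₀ (t₀ + L)) t) →
    (∀ t ∈ Icc t₀ (t₀ + L), HasDerivWithinAt Φ (Φ' t) (Icc t₀ (t₀ + L)) t) →
    (∀ t ∈ Icc t₀ (t₀ + L), ⟪c, x t⟫ ^ 2 + ‖g t‖ ^ 2 ≤ Φ' t) →
    ‖x (t₀ + L)‖ ^ 2 ≤ K * (Φ (t₀ + L) - Φ t₀)

omit [FiniteDimensional ℝ E] in
/-- The final state of `ẋ = B x + g` on a window of length one is controlled by the energies of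
`x` and `g`. -/
theorem sq_norm_le_of_energy {B : ℝ → E →L[ℝ] E} {x g : ℝ → E} {Φ Φ' : ℝ → ℝ} {t₀ β : ℝ}
    (hB : ∀ t ∈ Icc t₀ (t₀ + 1), ‖B t‖ ≤ β)
    (hx : ∀ t ∈ Icc t₀ (t₀ + 1), HasDerivWithinAt x (B t (x t) + g t) (Icc t₀ (t₀ + 1)) t)
    (hΦ : ∀ t ∈ Icc t₀ (t₀ + 1), HasDerivWithinAt Φ (Φ' t) (Icc t₀ (t₀ + 1)) t)
    (hle : ∀ t ∈ Icc t₀ (t₀ + 1), ‖x t‖ ^ 2 + ‖g t‖ ^ 2 ≤ Φ' t) :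
    ‖x (t₀ + 1)‖ ^ 2 ≤ (2 + 2 * β) * (Φ (t₀ + 1) - Φ t₀) := by
  have hβ : 0 ≤ β := (norm_nonneg _).trans (hB t₀ ⟨le_rfl, by linarith⟩)
  have key := le_of_hasDerivWithinAt_nonneg
    (f := fun t => (2 + 2 * β) * Φ t - (t - t₀) * ‖x t‖ ^ 2) (by linarith : t₀ ≤ t₀ + 1)
    (fun t ht => ((hΦ t ht).const_mul (2 + 2 * β)).sub
      (((hasDerivWithinAt_id t _).sub_const t₀).mul (hx t ht).norm_sq)) (fun t ht => by
      have h1 : ⟪x t, B t (x t) + g t⟫ ≤ β * ‖x t‖ ^ 2 + ‖x t‖ * ‖g t‖ := by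
        rw [inner_add_right]
        refine add_le_add ((real_inner_le_norm _ _).trans ?_) (real_inner_le_norm _ _)
        calc ‖x t‖ * ‖B t (x t)‖ ≤ ‖x t‖ * (β * ‖x t‖) := by
              gcongr; exact (B t).le_of_opNorm_le (hB t ht) _
          _ = _ := by ring
      have h2 : (t - t₀) * ⟪x t, B t (x t) + g t⟫
          ≤ β * ‖x t‖ ^ 2 + (‖x t‖ ^ 2 + ‖g t‖ ^ 2) / 2 := by
        have h3 : 0 ≤ β * ‖x t‖ ^ 2 + ‖x t‖ * ‖g t‖ := by positivity
        have h4 : t - t₀ ≤ 1 := by linarith [ht.2]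
        have h5 : 0 ≤ t - t₀ := by linarith [ht.1]
        calc _ ≤ (t - t₀) * (β * ‖x t‖ ^ 2 + ‖x t‖ * ‖g t‖) := by gcongr
          _ ≤ β * ‖x t‖ ^ 2 + ‖x t‖ * ‖g t‖ := mul_le_of_le_one_left h3 h4
          _ ≤ _ := by nlinarith [sq_nonneg (‖x t‖ - ‖g t‖)]
      have h6 := mul_le_mul_of_nonneg_left (hle t ht) (by positivity : 0 ≤ 2 + 2 * β)
      have h7 := mul_nonneg hβ (sq_nonneg ‖g t‖)
      simp only [id]
      nlinarith [sq_nonneg ‖g t‖])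
  simp only [sub_self, zero_mul, sub_zero, add_sub_cancel_left, one_mul] at key
  linarith

variable {A V : ℝ → E →L[ℝ] E} {q : ℝ → ℝ} {ε p₀ v qm β : ℝ} {c : E} {P₀ : E →L[ℝ] E}
  {Y Z : ℝ → E →L[ℝ] E}

omit [FiniteDimensional ℝ E] in
theorem apply_ringInverse_apply {T : E →L[ℝ] E} (hT : IsUnit T) (x : E) :
    T (Ring.inverse T x) = x :=
  DFunLike.congr_fun (Ring.mul_inverse_cancel T hT) x

namespace IsHamiltonianPair

/-- A bound by the form `⟨Y η, Z η⟩` that holds for large times holds for all times, since this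
form dominates its initial value `⟨P₀ η, η⟩`. -/
theorem exists_sq_norm_le (h : IsHamiltonianPair A V q c P₀ Y Z) (hd : IsRiccatiData A V q ε)
    (hp₀ : 0 < p₀) (hP₀ : ∀ x, p₀ * ‖x‖ ^ 2 ≤ ⟪P₀ x, x⟫) {X : ℝ → E →L[ℝ] E}
    (hX : ContinuousOn X (Ici 0)) {L K : ℝ}
    (hK : ∀ t, 0 ≤ t → ∀ η, ‖X (t + L) η‖ ^ 2 ≤ K * ⟪Y (t + L) η, Z (t + L) η⟫) :
    ∃ K', 0 < K' ∧ ∀ t, 0 ≤ t → ∀ η, ‖X t η‖ ^ 2 ≤ K' * ⟪Y t η, Z t η⟫ := by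
  obtain ⟨b, hb⟩ := isCompact_Icc.exists_bound_of_continuousOn
    (hX.mono (Icc_subset_Ici_self : Icc 0 L ⊆ Ici 0))
  refine ⟨b ^ 2 / p₀ + |K| + 1, by positivity, fun t ht η => ?_⟩
  have h1 := (hP₀ η).trans (h.inner_init_le hd η ht)
  have h0 : 0 ≤ ⟪Y t η, Z t η⟫ := le_trans (by positivity) h1
  rcases le_total t L with htL | htL
  · have h2 : ‖X t η‖ ^ 2 ≤ b ^ 2 * ‖η‖ ^ 2 := by
      rw [← mul_pow]
      exact pow_le_pow_left₀ (norm_nonneg _) ((X t).le_of_opNorm_le (hb t ⟨ht, htL⟩) η) 2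
    have h3 : b ^ 2 * ‖η‖ ^ 2 ≤ b ^ 2 / p₀ * ⟪Y t η, Z t η⟫ := by
      rw [div_mul_eq_mul_div, le_div_iff₀ hp₀]
      nlinarith [mul_le_mul_of_nonneg_left h1 (sq_nonneg b)]
    nlinarith [mul_nonneg (abs_nonneg K) h0]
  · have h2 := hK (t - L) (by linarith) η
    rw [sub_add_cancel] at h2
    have h3 := mul_le_mul_of_nonneg_right (le_abs_self K) h0
    have h4 : 0 ≤ b ^ 2 / p₀ * ⟪Y t η, Z t η⟫ := by positivity
    nlinarith

/-- `P` is bounded: `Y η` is a trajectory of the observed system, perturbed by `V Z η`. -/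
theorem exists_sq_norm_fst_le (h : IsHamiltonianPair A V q c P₀ Y Z)
    (hd : IsRiccatiData A V q ε)
    (hp₀ : 0 < p₀) (hP₀ : ∀ x, p₀ * ‖x‖ ^ 2 ≤ ⟪P₀ x, x⟫) (hobs : IsUniformlyObservable A c)
    (hv : ∀ t, 0 ≤ t → ‖V t‖ ≤ v) :
    ∃ K, 0 < K ∧ ∀ t, 0 ≤ t → ∀ η, ‖Y t η‖ ^ 2 ≤ K * ⟪Y t η, Z t η⟫ := by
  obtain ⟨L, K, hL, hK0, hK⟩ := hobs
  have hε := hd.pos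
  refine h.exists_sq_norm_le hd hp₀ hP₀ (fun t ht => (h.deriv_fst t ht).continuousWithinAt)
    (L := L) (K := K * ((1 + v ^ 2) / ε)) fun t ht η => ?_
  have hsub : Icc t (t + L) ⊆ Ici (0 : ℝ) := fun s hs => ht.trans hs.1
  have h1 := hK t (fun s => Y s η) (fun s => V s (Z s η))
    (fun s => (1 + v ^ 2) / ε * ⟪Y s η, Z s η⟫) _ ht
    (fun s hs => (h.deriv_fst_apply η (hsub hs)).mono hsub)
    (fun s hs => ((h.deriv_inner η (hsub hs)).mono hsub).const_mul _) (fun s hs => by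
      have h2 : ‖V s (Z s η)‖ ^ 2 ≤ v ^ 2 * ‖Z s η‖ ^ 2 := by
        rw [← mul_pow]
        exact pow_le_pow_left₀ (norm_nonneg _) ((V s).le_of_opNorm_le (hv s (hsub hs)) _) 2
      have h3 := hd.le_V s (hsub hs) (Z s η)
      have h4 := mul_le_mul_of_nonneg_right (hd.le_q s (hsub hs)) (sq_nonneg ⟪c, Y s η⟫)
      have h5 : 0 ≤ ε * ‖Z s η‖ ^ 2 := by positivity
      have h6 : 0 ≤ ε * ⟪c, Y s η⟫ ^ 2 := by positivity
      rw [div_mul_eq_mul_div, le_div_iff₀ hε]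
      nlinarith [mul_le_mul_of_nonneg_left h3 (sq_nonneg v),
        mul_le_mul_of_nonneg_left h4 (sq_nonneg v), mul_nonneg (sq_nonneg v) h6,
        mul_le_mul_of_nonneg_left h2 hε.le])
  refine h1.trans ?_
  have h2 := (mul_nonneg hp₀.le (sq_nonneg _)).trans ((hP₀ η).trans (h.inner_init_le hd η ht))
  have h3 : 0 ≤ (1 + v ^ 2) / ε * ⟪Y t η, Z t η⟫ := by positivity
  rw [mul_assoc]
  gcongr
  linarith

/-- `P⁻¹` is bounded: `Z η` is a trajectory of a system with bounded coefficients. -/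
theorem exists_sq_norm_snd_le (h : IsHamiltonianPair A V q c P₀ Y Z)
    (hd : IsRiccatiData A V q ε)
    (hp₀ : 0 < p₀) (hP₀ : ∀ x, p₀ * ‖x‖ ^ 2 ≤ ⟪P₀ x, x⟫)
    (hβ : ∀ t, 0 ≤ t → ‖A t‖ ≤ β) (hq : ∀ t, 0 ≤ t → q t ≤ qm) :
    ∃ K, 0 < K ∧ ∀ t, 0 ≤ t → ∀ η, ‖Z t η‖ ^ 2 ≤ K * ⟪Y t η, Z t η⟫ := by
  have hε := hd.pos
  have hβ0 : 0 ≤ β := (norm_nonneg _).trans (hβ 0 le_rfl)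
  have hqm : 0 ≤ qm := hε.le.trans ((hd.le_q 0 self_mem_Ici).trans (hq 0 le_rfl))
  refine h.exists_sq_norm_le hd hp₀ hP₀ (fun t ht => (h.deriv_snd t ht).continuousWithinAt)
    (L := 1) (K := (2 + 2 * β) * (1 / ε + qm * ‖c‖ ^ 2)) fun t ht η => ?_
  have hsub : Icc t (t + 1) ⊆ Ici (0 : ℝ) := fun s hs => ht.trans hs.1
  have h1 := sq_norm_le_of_energy (x := fun s => Z s η) (B := fun s => -adjoint (A s))
    (g := fun s => (q s * ⟪c, Y s η⟫) • c) (β := β)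
    (Φ := fun s => (1 / ε + qm * ‖c‖ ^ 2) * ⟪Y s η, Z s η⟫)
    (fun s hs => by
      rw [norm_neg, LinearIsometryEquiv.norm_map]; exact hβ s (hsub hs))
    (fun s hs => (h.deriv_snd_apply η (hsub hs)).mono hsub)
    (fun s hs => ((h.deriv_inner η (hsub hs)).mono hsub).const_mul _) (fun s hs => by
      have h2 : ‖(q s * ⟪c, Y s η⟫) • c‖ ^ 2 = q s * (q s * ⟪c, Y s η⟫ ^ 2) * ‖c‖ ^ 2 := by
        rw [norm_smul, mul_pow, Real.norm_eq_abs, sq_abs]; ring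
      have hq0 : 0 ≤ q s := hε.le.trans (hd.le_q s (hsub hs))
      have h3 : ‖(q s * ⟪c, Y s η⟫) • c‖ ^ 2
          ≤ qm * ‖c‖ ^ 2 * (q s * ⟪c, Y s η⟫ ^ 2) := by
        rw [h2]
        calc _ ≤ qm * (q s * ⟪c, Y s η⟫ ^ 2) * ‖c‖ ^ 2 := by gcongr; exact hq s (hsub hs)
          _ = _ := by ring
      have h4 : ‖Z s η‖ ^ 2 ≤ 1 / ε * ⟪V s (Z s η), Z s η⟫ := by
        rw [one_div, inv_mul_eq_div, le_div_iff₀ hε, mul_comm]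
        exact hd.le_V s (hsub hs) _
      have h5 : 0 ≤ ⟪V s (Z s η), Z s η⟫ :=
        le_trans (by positivity) (hd.le_V s (hsub hs) (Z s η))
      have h6 : 0 ≤ qm * ‖c‖ ^ 2 * ⟪V s (Z s η), Z s η⟫ := by positivity
      have h7 : 0 ≤ 1 / ε * (q s * ⟪c, Y s η⟫ ^ 2) := by positivity
      linarith)
  refine h1.trans ?_
  have h2 := (mul_nonneg hp₀.le (sq_nonneg _)).trans ((hP₀ η).trans (h.inner_init_le hd η ht))
  have h3 : 0 ≤ (1 / ε + qm * ‖c‖ ^ 2) * ⟪Y t η, Z t η⟫ := by positivity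
  rw [mul_assoc]
  gcongr
  linarith

theorem inner_riccatiOf_comm (h : IsHamiltonianPair A V q c P₀ Y Z)
    (hd : IsRiccatiData A V q ε) (hP₀ : ∀ x y, ⟪P₀ x, y⟫ = ⟪x, P₀ y⟫) {t : ℝ} (ht : 0 ≤ t)
    (hZ : IsUnit (Z t)) (x y : E) : ⟪riccatiOf Y Z t x, y⟫ = ⟪x, riccatiOf Y Z t y⟫ := by
  have hz : ∀ x, Z t (Ring.inverse (Z t) x) = x := apply_ringInverse_apply hZ
  have := h.inner_comm hd hP₀ (Ring.inverse (Z t) x) (Ring.inverse (Z t) y) ht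
  rwa [hz, hz] at this

theorem inner_riccatiOf_pos (h : IsHamiltonianPair A V q c P₀ Y Z)
    (hd : IsRiccatiData A V q ε) (hp₀ : 0 < p₀) (hP₀ : ∀ x, p₀ * ‖x‖ ^ 2 ≤ ⟪P₀ x, x⟫)
    {t : ℝ} (ht : 0 ≤ t) {x : E} (hx : x ≠ 0) : 0 < ⟪riccatiOf Y Z t x, x⟫ := by
  have hZ := h.isUnit_snd hd hp₀ hP₀ ht
  have hz : ∀ x, Z t (Ring.inverse (Z t) x) = x := apply_ringInverse_apply hZ
  have := h.inner_pos hd hp₀ hP₀ (η := Ring.inverse (Z t) x)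
    (fun h0 => hx (by rw [← hz x, h0, map_zero])) ht
  rwa [hz] at this

/-- Along the error dynamics the Lyapunov function `⟨e, P⁻¹ e⟩` decreases at least at the rate
`⟨P⁻¹ e, V P⁻¹ e⟩`, because `2 k ≥ 1`. -/
theorem deriv_lyapunov (h : IsHamiltonianPair A V q c P₀ Y Z) (hd : IsRiccatiData A V q ε)
    (hp₀ : 0 < p₀) (hP₀ : ∀ x, p₀ * ‖x‖ ^ 2 ≤ ⟪P₀ x, x⟫)
    (hP₀s : ∀ x y, ⟪P₀ x, y⟫ = ⟪x, P₀ y⟫) {k : ℝ → ℝ} {e : ℝ → E} {t : ℝ} (ht : 0 ≤ t)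
    (he : HasDerivWithinAt e (A t (e t) - (k t * q t * ⟪c, e t⟫) • riccatiOf Y Z t c)
      (Ici 0) t) :
    HasDerivWithinAt (fun s => ⟪e s, informationOf Y Z s (e s)⟫)
      (-((2 * k t - 1) * (q t * ⟪c, e t⟫ ^ 2)
        + ⟪V t (informationOf Y Z t (e t)), informationOf Y Z t (e t)⟫)) (Ici 0) t := by
  have hY := h.isUnit_fst hd hp₀ hP₀ ht
  have hZ := h.isUnit_snd hd hp₀ hP₀ ht
  have hy : ∀ x, Y t (Ring.inverse (Y t) x) = x := apply_ringInverse_apply hY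
  have hz : ∀ x, Z t (Ring.inverse (Z t) x) = x := apply_ringInverse_apply hZ
  have hMs : ∀ y, ⟪e t, informationOf Y Z t y⟫ = ⟪informationOf Y Z t (e t), y⟫ := fun y => by
    have := h.inner_comm hd hP₀s (Ring.inverse (Y t) (e t)) (Ring.inverse (Y t) y) ht
    rwa [hy, hy] at this
  have hMP : ⟪informationOf Y Z t (e t), riccatiOf Y Z t c⟫ = ⟪c, e t⟫ := by
    have := h.inner_comm hd hP₀s (Ring.inverse (Y t) (e t)) (Ring.inverse (Z t) c) ht
    rw [hy, hz] at this
    rw [real_inner_comm (e t) c]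
    exact this.symm
  refine (he.inner ℝ ((h.hasDerivWithinAt_informationOf ht hY).clm_apply he)).congr_deriv ?_
  simp only [add_apply, sub_apply, neg_apply, mul_def, comp_apply, smul_apply, rankOne_apply,
    map_sub, map_smul, inner_add_right, inner_sub_right, inner_neg_right, inner_sub_left,
    inner_smul_left, inner_smul_right, adjoint_inner_right, hMs, hMP]
  simp only [RCLike.conj_to_real, real_inner_comm (A t (e t)),
    real_inner_comm _ (riccatiOf Y Z t c), hMP,
    real_inner_comm (V t (informationOf Y Z t (e t))), real_inner_comm c]
  ring

/-- Exponential stability of the error dynamics `ė = (A - k P Q) e`, uniformly in the solution. -/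
theorem exists_exponential_bound (h : IsHamiltonianPair A V q c P₀ Y Z)
    (hd : IsRiccatiData A V q ε) (hp₀ : 0 < p₀) (hP₀ : ∀ x, p₀ * ‖x‖ ^ 2 ≤ ⟪P₀ x, x⟫)
    (hP₀s : ∀ x y, ⟪P₀ x, y⟫ = ⟪x, P₀ y⟫) (hobs : IsUniformlyObservable A c)
    (hβ : ∀ t, 0 ≤ t → ‖A t‖ ≤ β) (hv : ∀ t, 0 ≤ t → ‖V t‖ ≤ v) (hq : ∀ t, 0 ≤ t → q t ≤ qm)
    {k : ℝ → ℝ} (hk : ∀ t, 0 ≤ t → 1 / 2 ≤ k t) :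
    ∃ C γ : ℝ, 0 < C ∧ 0 < γ ∧ ∀ e : ℝ → E,
      (∀ t, 0 ≤ t → HasDerivWithinAt e
        (A t (e t) - (k t * q t * ⟪c, e t⟫) • riccatiOf Y Z t c) (Ici 0) t) →
      ∀ s t, 0 ≤ s → s ≤ t → ‖e t‖ ≤ C * Real.exp (-γ * (t - s)) * ‖e s‖ := by
  obtain ⟨K, hK, hYK⟩ := h.exists_sq_norm_fst_le hd hp₀ hP₀ hobs hv
  obtain ⟨K', hK', hZK⟩ := h.exists_sq_norm_snd_le hd hp₀ hP₀ hβ hq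
  have hε := hd.pos
  refine ⟨√(K * K'), ε / K / 2, by positivity, by positivity, fun e he s t hs hst => ?_⟩
  set l : ℝ → ℝ := fun r => ⟪e r, informationOf Y Z r (e r)⟫ with hl
  have hyl : ∀ r, 0 ≤ r → ‖e r‖ ^ 2 ≤ K * l r := fun r hr => by
    have := hYK r hr (Ring.inverse (Y r) (e r))
    rwa [apply_ringInverse_apply (h.isUnit_fst hd hp₀ hP₀ hr)] at this
  have hzl : ∀ r, 0 ≤ r → ‖informationOf Y Z r (e r)‖ ^ 2 ≤ K' * l r := fun r hr => by
    have := hZK r hr (Ring.inverse (Y r) (e r))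
    rwa [apply_ringInverse_apply (h.isUnit_fst hd hp₀ hP₀ hr)] at this
  have hl0 : ∀ r, 0 ≤ r → 0 ≤ l r := fun r hr =>
    nonneg_of_mul_nonneg_right ((sq_nonneg _).trans (hyl r hr)) hK
  have hCS : ∀ r, 0 ≤ r → l r * l r ≤ ‖e r‖ ^ 2 * ‖informationOf Y Z r (e r)‖ ^ 2 :=
    fun r hr => by
      rw [← mul_pow, ← sq]
      exact pow_le_pow_left₀ (hl0 r hr) (real_inner_le_norm _ _) 2
  -- Both comparisons follow from Cauchy-Schwarz after division by `l r`, when it is nonzero.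
  have hle : ∀ r, 0 ≤ r → l r ≤ K * ‖informationOf Y Z r (e r)‖ ^ 2 := fun r hr => by
    rcases (hl0 r hr).eq_or_lt with h0 | h0
    · rw [← h0]; positivity
    · refine le_of_mul_le_mul_right ?_ h0
      nlinarith [hCS r hr, mul_le_mul_of_nonneg_right (hyl r hr)
        (sq_nonneg ‖informationOf Y Z r (e r)‖)]
  have hle' : ∀ r, 0 ≤ r → l r ≤ K' * ‖e r‖ ^ 2 := fun r hr => by
    rcases (hl0 r hr).eq_or_lt with h0 | h0
    · rw [← h0]; positivity
    · refine le_of_mul_le_mul_right ?_ h0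
      nlinarith [hCS r hr, mul_le_mul_of_nonneg_left (hzl r hr) (sq_nonneg ‖e r‖)]
  have hsub : Icc s t ⊆ Ici (0 : ℝ) := fun r hr => hs.trans hr.1
  have hdecay := le_of_hasDerivWithinAt_nonneg hst
    (f := fun r => -(Real.exp (ε / K * r) * l r))
    (fun r hr => ((((hasDerivWithinAt_id r _).const_mul (ε / K)).exp.mul
      ((h.deriv_lyapunov hd hp₀ hP₀ hP₀s (hsub hr) (he r (hsub hr))).mono hsub))).neg)
    (fun r hr => by
      have hr0 : 0 ≤ r := hsub hr
      have h1 : ε / K * l r ≤ ε * ‖informationOf Y Z r (e r)‖ ^ 2 := by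
        rw [div_mul_eq_mul_div, div_le_iff₀ hK]
        nlinarith [mul_le_mul_of_nonneg_left (hle r hr0) hε.le]
      have h2 := hd.le_V r hr0 (informationOf Y Z r (e r))
      have h3 : 0 ≤ (2 * k r - 1) * (q r * ⟪c, e r⟫ ^ 2) :=
        mul_nonneg (by linarith [hk r hr0])
          (mul_nonneg (hε.le.trans (hd.le_q r hr0)) (sq_nonneg _))
      have h4 := Real.exp_pos (ε / K * r)
      have h5 : 0 ≤ Real.exp (ε / K * r) * ((2 * k r - 1) * (q r * ⟪c, e r⟫ ^ 2)
          + ⟪V r (informationOf Y Z r (e r)), informationOf Y Z r (e r)⟫ - ε / K * l r) :=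
        mul_nonneg h4.le (by linarith)
      simp only [id]
      linarith)
  have hexp : Real.exp (ε / K * s) = Real.exp (ε / K * t) * Real.exp (-(ε / K * (t - s))) := by
    rw [← Real.exp_add]; congr 1; ring
  have hlt : l t ≤ Real.exp (-(ε / K * (t - s))) * l s := by
    refine le_of_mul_le_mul_left ?_ (Real.exp_pos (ε / K * t))
    rw [← mul_assoc, ← hexp]
    linarith
  refine (sq_le_sq₀ (norm_nonneg _) (by positivity)).1 ?_
  have hsq : (√(K * K') * Real.exp (-(ε / K / 2) * (t - s)) * ‖e s‖) ^ 2
      = K * (Real.exp (-(ε / K * (t - s))) * (K' * ‖e s‖ ^ 2)) := by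
    rw [mul_pow, mul_pow, Real.sq_sqrt (by positivity), ← Real.exp_nat_mul]
    rw [show ((2 : ℕ) : ℝ) * (-(ε / K / 2) * (t - s)) = -(ε / K * (t - s)) by push_cast; ring]
    ring
  rw [hsq]
  refine (hyl t (hs.trans hst)).trans ?_
  gcongr
  refine hlt.trans ?_
  gcongr
  exact hle' s hs

end IsHamiltonianPair

end Stability

end RangeObserver

/-! ### Uniform observability under persistent excitation -/

namespace RangeObserver

section Observability

open Set
open scoped NNReal RealInnerProductSpace

theorem exists_subinterval {a L l t : ℝ} (hl : 0 ≤ l) (hlL : l ≤ L) (ht : t ∈ Icc a (a + L)) :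
    ∃ s, t ∈ Icc s (s + l) ∧ Icc s (s + l) ⊆ Icc a (a + L) := by
  refine ⟨min t (a + L - l), ⟨min_le_left _ _, ?_⟩, Icc_subset_Icc (le_min ht.1 (by linarith)) ?_⟩
  · rcases min_choice t (a + L - l) with h | h <;> rw [h] <;> linarith [ht.2]
  · linarith [min_le_right t (a + L - l)]

/-- A function with bounded derivative and small energy is small. -/
theorem exists_abs_le_of_energy {L M ε : ℝ} (hL : 0 < L) (hM : 0 ≤ M) (hε : 0 < ε) :
    ∃ η, 0 < η ∧ ∀ (a : ℝ) (f f' Φ Φ' : ℝ → ℝ),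
      (∀ t ∈ Icc a (a + L), HasDerivWithinAt f (f' t) (Icc a (a + L)) t) →
      (∀ t ∈ Icc a (a + L), HasDerivWithinAt Φ (Φ' t) (Icc a (a + L)) t) →
      (∀ t ∈ Icc a (a + L), |f' t| ≤ M) → (∀ t ∈ Icc a (a + L), f t ^ 2 ≤ Φ' t) →
      Φ (a + L) - Φ a < η → ∀ t ∈ Icc a (a + L), |f t| ≤ ε := by
  -- On an interval of length `l` around `t`, the function varies by at most `ε / 2`.
  set l : ℝ := min L (ε / (2 * (M + 1))) with hl
  have hl0 : 0 < l := lt_min hL (by positivity)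
  have hlM : M * l ≤ ε / 2 := by
    have h1 : l * (2 * (M + 1)) ≤ ε := (le_div_iff₀ (by positivity)).1 (min_le_right _ _)
    nlinarith
  refine ⟨l * (ε / 2) ^ 2, by positivity, fun a f f' Φ Φ' hf hΦ hM' hle hlt t ht => ?_⟩
  by_contra! hcon
  obtain ⟨s, hts, hsub⟩ := exists_subinterval hl0.le (min_le_left _ _) ht
  have hsl : s ≤ s + l := by linarith
  have hlow : ∀ r ∈ Icc s (s + l), (ε / 2) ^ 2 ≤ Φ' r := fun r hr => by
    have h1 := (convex_Icc s (s + l)).norm_image_sub_le_of_norm_hasDerivWithin_le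
      (fun x hx => (hf x (hsub hx)).mono hsub) (fun x hx => hM' x (hsub hx)) hr hts
    rw [Real.norm_eq_abs, Real.norm_eq_abs] at h1
    have h2 : |t - r| ≤ l := by rw [abs_le]; constructor <;> linarith [hr.1, hr.2, hts.1, hts.2]
    have h3 := abs_sub_abs_le_abs_sub (f t) (f r)
    have h4 : M * |t - r| ≤ M * l := by gcongr
    have h5 : ε / 2 ≤ |f r| := by linarith
    calc (ε / 2) ^ 2 ≤ |f r| ^ 2 := by gcongr
      _ = f r ^ 2 := sq_abs _
      _ ≤ _ := hle r (hsub hr)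
  have h1 := le_of_hasDerivWithinAt_nonneg (f := fun r => Φ r - (ε / 2) ^ 2 * r) hsl
    (fun r hr => ((hΦ r (hsub hr)).mono hsub).sub ((hasDerivWithinAt_id r _).const_mul _))
    (fun r hr => by have := hlow r hr; linarith)
  have hs := hsub (left_mem_Icc.2 hsl)
  have hs' := hsub (right_mem_Icc.2 hsl)
  have hsub1 : Icc a s ⊆ Icc a (a + L) := Icc_subset_Icc_right hs.2
  have hsub2 : Icc (s + l) (a + L) ⊆ Icc a (a + L) := Icc_subset_Icc_left hs'.1
  have h2 := le_of_hasDerivWithinAt_nonneg hs.1 (fun r hr => (hΦ r (hsub1 hr)).mono hsub1)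
    (fun r hr => (sq_nonneg _).trans (hle r (hsub1 hr)))
  have h3 := le_of_hasDerivWithinAt_nonneg hs'.2 (fun r hr => (hΦ r (hsub2 hr)).mono hsub2)
    (fun r hr => (sq_nonneg _).trans (hle r (hsub2 hr)))
  linarith

/-- Landau's principle: a small function with bounded second derivative has small derivative. -/
theorem exists_abs_deriv_le {L M ε : ℝ} (hL : 0 < L) (hM : 0 ≤ M) (hε : 0 < ε) :
    ∃ η, 0 < η ∧ ∀ (a : ℝ) (f f' f'' : ℝ → ℝ),
      (∀ t ∈ Icc a (a + L), HasDerivWithinAt f (f' t) (Icc a (a + L)) t) →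
      (∀ t ∈ Icc a (a + L), HasDerivWithinAt f' (f'' t) (Icc a (a + L)) t) →
      (∀ t ∈ Icc a (a + L), |f'' t| ≤ M) → (∀ t ∈ Icc a (a + L), |f t| ≤ η) →
      ∀ t ∈ Icc a (a + L), |f' t| ≤ ε := by
  set l : ℝ := min L (ε / (2 * (M + 1))) with hl
  have hl0 : 0 < l := lt_min hL (by positivity)
  have hlM : M * l ≤ ε / 2 := by
    have h1 : l * (2 * (M + 1)) ≤ ε := (le_div_iff₀ (by positivity)).1 (min_le_right _ _)
    nlinarith
  refine ⟨l * ε / 4, by positivity, fun a f f' f'' hf hf' hM' hle t ht => ?_⟩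
  obtain ⟨s, hts, hsub⟩ := exists_subinterval hl0.le (min_le_left _ _) ht
  have hsl : s ≤ s + l := by linarith
  have hvar : ∀ r ∈ Icc s (s + l), ‖f' r - f' t‖ ≤ ε / 2 := fun r hr => by
    have h1 := (convex_Icc s (s + l)).norm_image_sub_le_of_norm_hasDerivWithin_le
      (fun x hx => (hf' x (hsub hx)).mono hsub) (fun x hx => hM' x (hsub hx)) hts hr
    have h2 : ‖r - t‖ ≤ l := by
      rw [Real.norm_eq_abs, abs_le]; constructor <;> linarith [hr.1, hr.2, hts.1, hts.2]
    exact h1.trans ((mul_le_mul_of_nonneg_left h2 hM).trans hlM)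
  have h1 := (convex_Icc s (s + l)).norm_image_sub_le_of_norm_hasDerivWithin_le
    (f := fun r => f r - r * f' t) (f' := fun r => f' r - 1 * f' t)
    (fun r hr => ((hf r (hsub hr)).mono hsub).sub ((hasDerivWithinAt_id r _).mul_const _))
    (by simpa using hvar) (left_mem_Icc.2 hsl) (right_mem_Icc.2 hsl)
  have h2 := hle _ (hsub (left_mem_Icc.2 hsl))
  have h3 := hle _ (hsub (right_mem_Icc.2 hsl))
  rw [Real.norm_eq_abs, Real.norm_eq_abs, add_sub_cancel_left, abs_of_pos hl0] at h1
  have h4 : l * |f' t| ≤ l * ε := by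
    rw [← abs_of_pos hl0, ← abs_mul, abs_of_pos hl0]
    rw [abs_le] at h1 h2 h3 ⊢
    constructor <;> nlinarith
  exact le_of_mul_le_mul_left h4 hl0

variable {H : Type*} [NormedAddCommGroup H] [InnerProductSpace ℝ H]

/-- A trajectory on `[t₀, t₀ + L]` of the unperturbed extended system: the position `p` moves with
constant velocity `a`, the output `y` satisfies `ẏ = uᵀp + z`, and `ż = uᵀa + w` with `w`
constant. -/
structure IsFreeTrajectory (u : ℝ → H) (t₀ L : ℝ) (p : ℝ → H) (a : H) (y z : ℝ → ℝ) (w : ℝ) :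
    Prop where
  deriv_p : ∀ t ∈ Icc t₀ (t₀ + L), HasDerivWithinAt p a (Icc t₀ (t₀ + L)) t
  deriv_y : ∀ t ∈ Icc t₀ (t₀ + L), HasDerivWithinAt y (⟪u t, p t⟫ + z t) (Icc t₀ (t₀ + L)) t
  deriv_z : ∀ t ∈ Icc t₀ (t₀ + L), HasDerivWithinAt z (⟪u t, a⟫ + w) (Icc t₀ (t₀ + L)) t

/-- The input `u` has derivatives `u₁` and `u₂` on `[0, ∞)`, all bounded, and no vector `p` with
`‖p‖ > R / √μ` satisfies `|⟨u₁, p⟩| ≤ R` on a whole window of length `δ`. -/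
structure IsExcitingInput (u u₁ u₂ : ℝ → H) (U U₁ U₂ δ μ : ℝ) : Prop where
  deriv : ∀ t ∈ Ici (0 : ℝ), HasDerivWithinAt u (u₁ t) (Ici 0) t
  deriv_deriv : ∀ t ∈ Ici (0 : ℝ), HasDerivWithinAt u₁ (u₂ t) (Ici 0) t
  le_U : ∀ t ∈ Ici (0 : ℝ), ‖u t‖ ≤ U
  le_U₁ : ∀ t ∈ Ici (0 : ℝ), ‖u₁ t‖ ≤ U₁
  le_U₂ : ∀ t ∈ Ici (0 : ℝ), ‖u₂ t‖ ≤ U₂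
  pos_δ : 0 < δ
  pos_μ : 0 < μ
  excite : ∀ s ∈ Ici (0 : ℝ), ∀ (p : H) (R : ℝ), 0 ≤ R →
    (∀ t ∈ Icc s (s + δ), |⟪u₁ t, p⟫| ≤ R) → √μ * ‖p‖ ≤ R

variable {u u₁ u₂ p : ℝ → H} {U U₁ U₂ δ μ t₀ L w ε : ℝ} {a : H} {y z : ℝ → ℝ}

theorem abs_inner_le_of_le {x x' : H} {b b' : ℝ} (h : ‖x‖ ≤ b) (h' : ‖x'‖ ≤ b') :
    |⟪x, x'⟫| ≤ b * b' :=
  (abs_real_inner_le_norm x x').trans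
    (mul_le_mul h h' (norm_nonneg _) ((norm_nonneg _).trans h))

namespace IsFreeTrajectory

theorem p_sub_eq (h : IsFreeTrajectory u t₀ L p a y z w) {s t : ℝ}
    (hs : s ∈ Icc t₀ (t₀ + L)) (ht : t ∈ Icc t₀ (t₀ + L)) : p t - p s = (t - s) • a := by
  have h1 := (convex_Icc t₀ (t₀ + L)).norm_image_sub_le_of_norm_hasDerivWithin_le
    (f := fun r => p r - r • a) (f' := fun _ => a - (1 : ℝ) • a) (C := 0)
    (fun r hr => (h.deriv_p r hr).sub ((hasDerivWithinAt_id r _).smul_const a)) (by simp) hs ht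
  rw [zero_mul, norm_le_zero_iff] at h1
  rw [sub_smul, ← sub_eq_zero, ← h1]
  abel

theorem hasDerivWithinAt_fst (h : IsFreeTrajectory u t₀ L p a y z w)
    (hu : IsExcitingInput u u₁ u₂ U U₁ U₂ δ μ) (ht₀ : 0 ≤ t₀) {t : ℝ}
    (ht : t ∈ Icc t₀ (t₀ + L)) :
    HasDerivWithinAt (fun s => ⟪u s, p s⟫ + z s) (⟪u₁ t, p t⟫ + 2 * ⟪u t, a⟫ + w)
      (Icc t₀ (t₀ + L)) t := by
  have hsub : Icc t₀ (t₀ + L) ⊆ Ici (0 : ℝ) := fun s hs => ht₀.trans hs.1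
  refine ((((hu.deriv t (hsub ht)).mono hsub).inner ℝ (h.deriv_p t ht)).add
    (h.deriv_z t ht)).congr_deriv ?_
  ring

theorem hasDerivWithinAt_snd (h : IsFreeTrajectory u t₀ L p a y z w)
    (hu : IsExcitingInput u u₁ u₂ U U₁ U₂ δ μ) (ht₀ : 0 ≤ t₀) {t : ℝ}
    (ht : t ∈ Icc t₀ (t₀ + L)) :
    HasDerivWithinAt (fun s => ⟪u₁ s, p s⟫ + 2 * ⟪u s, a⟫ + w) (⟪u₂ t, p t⟫ + 3 * ⟪u₁ t, a⟫)
      (Icc t₀ (t₀ + L)) t := by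
  have hsub : Icc t₀ (t₀ + L) ⊆ Ici (0 : ℝ) := fun s hs => ht₀.trans hs.1
  refine (((((hu.deriv_deriv t (hsub ht)).mono hsub).inner ℝ (h.deriv_p t ht)).add
    ((((hu.deriv t (hsub ht)).mono hsub).inner ℝ
      (hasDerivWithinAt_const t _ a)).const_mul 2)).add_const w).congr_deriv ?_
  rw [inner_zero_right]
  ring

/-- On a sufficiently long window, small first and second derivatives of the output force the
position, the bias and the remaining constants of a free trajectory to be small. -/
theorem bounds_of_small_derivs (h : IsFreeTrajectory u t₀ L p a y z w)
    (hu : IsExcitingInput u u₁ u₂ U U₁ U₂ δ μ) (ht₀ : 0 ≤ t₀) (hδL : δ ≤ L) (hL : 1 ≤ L)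
    (hLμ : 4 * U + 2 * (2 * U + U₁ * δ) + 1 ≤ L * √μ)
    (h1 : ∀ t ∈ Icc t₀ (t₀ + L), |⟪u t, p t⟫ + z t| ≤ ε)
    (h2 : ∀ t ∈ Icc t₀ (t₀ + L), |⟪u₁ t, p t⟫ + 2 * ⟪u t, a⟫ + w| ≤ ε) :
    ‖p (t₀ + L)‖ ≤ (2 + L) * ε ∧ ‖a‖ ≤ 2 * ((2 + L) * ε) ∧
      |z (t₀ + L)| ≤ ε + U * ((2 + L) * ε) ∧ |w| ≤ 2 * ε + 4 * (U * ((2 + L) * ε)) := by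
  have hsub : Icc t₀ (t₀ + L) ⊆ Ici (0 : ℝ) := fun s hs => ht₀.trans hs.1
  have hm0 : t₀ ∈ Icc t₀ (t₀ + L) := ⟨le_rfl, by linarith⟩
  have hm1 : t₀ + L ∈ Icc t₀ (t₀ + L) := ⟨by linarith, le_rfl⟩
  have hU : 0 ≤ U := (norm_nonneg _).trans (hu.le_U 0 self_mem_Ici)
  have hU₁ : 0 ≤ U₁ := (norm_nonneg _).trans (hu.le_U₁ 0 self_mem_Ici)
  have hδ := hu.pos_δ
  have hε : 0 ≤ ε := (abs_nonneg _).trans (h1 t₀ hm0)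
  set pm : ℝ := max ‖p t₀‖ ‖p (t₀ + L)‖ with hpm
  have hpm0 : ‖p t₀‖ ≤ pm := le_max_left _ _
  have hpm1 : ‖p (t₀ + L)‖ ≤ pm := le_max_right _ _
  have hpmn : 0 ≤ pm := (norm_nonneg _).trans hpm0
  have ha0 := norm_nonneg a
  -- The position moves by `L a` over the window.
  have haL : L * ‖a‖ ≤ 2 * pm := by
    have h3 := h.p_sub_eq hm0 hm1
    rw [add_sub_cancel_left] at h3
    have h4 := norm_sub_le (p (t₀ + L)) (p t₀)
    rw [h3, norm_smul, Real.norm_of_nonneg (by linarith : 0 ≤ L)] at h4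
    linarith
  -- Excitation is used at whichever end of the window the position is largest.
  have hexc : ∀ s ∈ Icc t₀ (t₀ + L), ∀ r, t₀ ≤ r → r + δ ≤ t₀ + L → s ∈ Icc r (r + δ) →
      √μ * ‖p s‖ ≤ |w| + ε + (2 * U + U₁ * δ) * ‖a‖ := fun s hs r hr hr' hsr => by
    refine hu.excite r (ht₀.trans hr) (p s) _ (by positivity) fun t ht => ?_
    have htI : t ∈ Icc t₀ (t₀ + L) := ⟨hr.trans ht.1, ht.2.trans hr'⟩
    have h3 := h.p_sub_eq htI hs
    have h4 : ‖p s - p t‖ ≤ δ * ‖a‖ := by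
      rw [h3, norm_smul]
      gcongr
      rw [Real.norm_eq_abs, abs_le]
      constructor <;> linarith [ht.1, ht.2, hsr.1, hsr.2]
    have h5 : ⟪u₁ t, p s⟫ = (⟪u₁ t, p t⟫ + 2 * ⟪u t, a⟫ + w) - 2 * ⟪u t, a⟫ - w
        + ⟪u₁ t, p s - p t⟫ := by rw [inner_sub_right]; ring
    have h6 := abs_inner_le_of_le (hu.le_U₁ t (hsub htI)) h4
    have h7 := abs_inner_le_of_le (hu.le_U t (hsub htI)) (le_refl ‖a‖)
    have h8 := h2 t htI
    rw [h5]
    have h9 := abs_le.1 h6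
    have h10 := abs_le.1 h7
    have h11 := abs_le.1 h8
    have h12 := neg_abs_le w
    have h13 := le_abs_self w
    rw [abs_le]
    constructor <;> linarith
  have hexcm : √μ * pm ≤ |w| + ε + (2 * U + U₁ * δ) * ‖a‖ := by
    rcases max_choice ‖p t₀‖ ‖p (t₀ + L)‖ with hc | hc
    · rw [hpm, hc]
      exact hexc t₀ hm0 t₀ le_rfl (by linarith) ⟨le_rfl, by linarith⟩
    · rw [hpm, hc]
      exact hexc (t₀ + L) hm1 (t₀ + L - δ) (by linarith) (by linarith)
        ⟨by linarith, by linarith⟩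
  -- The increment of `z` over the window, computed from its derivative, bounds the constant `w`.
  have hw : L * |w| ≤ 2 * ε + 2 * (U * pm) + L * (U * ‖a‖) := by
    have h3 := (convex_Icc t₀ (t₀ + L)).norm_image_sub_le_of_norm_hasDerivWithin_le
      (f := fun r => z r - r * w) (f' := fun r => ⟪u r, a⟫ + w - 1 * w) (C := U * ‖a‖)
      (fun r hr => (h.deriv_z r hr).sub ((hasDerivWithinAt_id r _).mul_const w))
      (fun r hr => by
        have := abs_inner_le_of_le (hu.le_U r (hsub hr)) (le_refl ‖a‖)
        simpa using this) hm0 hm1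
    rw [Real.norm_eq_abs, add_sub_cancel_left, Real.norm_of_nonneg (by linarith : 0 ≤ L)] at h3
    have h4 := abs_le.1 (abs_inner_le_of_le (hu.le_U t₀ (hsub hm0)) hpm0)
    have h5 := abs_le.1 (abs_inner_le_of_le (hu.le_U _ (hsub hm1)) hpm1)
    have h6 := abs_le.1 (h1 t₀ hm0)
    have h7 := abs_le.1 (h1 _ hm1)
    have h8 := abs_le.1 h3
    have h9 : |L * w| ≤ 2 * ε + 2 * (U * pm) + L * (U * ‖a‖) := by
      rw [abs_le]; constructor <;> linarith
    rwa [abs_mul, abs_of_nonneg (by linarith : 0 ≤ L)] at h9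
  have hpmε : pm ≤ (2 + L) * ε := by
    have h3 : (4 * U + 2 * (2 * U + U₁ * δ) + 1) * pm ≤ L * √μ * pm := by gcongr
    have h4 : L * (√μ * pm) ≤ L * (|w| + ε + (2 * U + U₁ * δ) * ‖a‖) := by gcongr
    have h5 : (U + (2 * U + U₁ * δ)) * (L * ‖a‖) ≤ (U + (2 * U + U₁ * δ)) * (2 * pm) := by
      gcongr
    linarith
  have ha : ‖a‖ ≤ 2 * pm := by nlinarith
  have hw' : |w| ≤ 2 * ε + 2 * (U * pm) + U * ‖a‖ := by
    have h3 : 0 ≤ (L - 1) * (2 * ε + 2 * (U * pm)) :=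
      mul_nonneg (by linarith) (by positivity)
    refine le_of_mul_le_mul_left ?_ (by linarith : 0 < L)
    linarith
  have hUpm : U * pm ≤ U * ((2 + L) * ε) := by gcongr
  have hUa : U * ‖a‖ ≤ U * (2 * pm) := by gcongr
  refine ⟨hpm1.trans hpmε, by linarith, ?_, by linarith⟩
  have h5 := abs_le.1 (abs_inner_le_of_le (hu.le_U _ (hsub hm1)) hpm1)
  have h7 := abs_le.1 (h1 _ hm1)
  rw [abs_le]
  constructor <;> linarith

end IsFreeTrajectory

end Observability

end RangeObserver

namespace RangeObserver

section FreeObservability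

open Set
open scoped NNReal RealInnerProductSpace

variable {H : Type*} [NormedAddCommGroup H] [InnerProductSpace ℝ H]

variable {u u₁ u₂ p : ℝ → H} {U U₁ U₂ δ μ t₀ L w ε : ℝ} {a : H} {y z : ℝ → ℝ}

namespace IsFreeTrajectory

theorem smul (h : IsFreeTrajectory u t₀ L p a y z w) (r : ℝ) :
    IsFreeTrajectory u t₀ L (fun t => r • p t) (r • a) (fun t => r * y t) (fun t => r * z t)
      (r * w) where
  deriv_p t ht := (h.deriv_p t ht).const_smul r
  deriv_y t ht := ((h.deriv_y t ht).const_mul r).congr_deriv (by rw [inner_smul_right]; ring)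
  deriv_z t ht := ((h.deriv_z t ht).const_mul r).congr_deriv (by rw [inner_smul_right]; ring)

/-- A free trajectory whose output and its first two derivatives are small has a small final
state. -/
theorem sq_norm_lt_one (h : IsFreeTrajectory u t₀ L p a y z w)
    (hu : IsExcitingInput u u₁ u₂ U U₁ U₂ δ μ) (ht₀ : 0 ≤ t₀) (hδL : δ ≤ L) (hL : 1 ≤ L)
    (hLμ : 4 * U + 2 * (2 * U + U₁ * δ) + 1 ≤ L * √μ)
    (hε : ε ^ 2 * ((2 + L) ^ 2 + (2 * (2 + L)) ^ 2 + 1 + (1 + U * (2 + L)) ^ 2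
      + (2 + 4 * (U * (2 + L))) ^ 2) < 1)
    (h0 : ∀ t ∈ Icc t₀ (t₀ + L), |y t| ≤ ε)
    (h1 : ∀ t ∈ Icc t₀ (t₀ + L), |⟪u t, p t⟫ + z t| ≤ ε)
    (h2 : ∀ t ∈ Icc t₀ (t₀ + L), |⟪u₁ t, p t⟫ + 2 * ⟪u t, a⟫ + w| ≤ ε) :
    ‖p (t₀ + L)‖ ^ 2 + ‖a‖ ^ 2 + y (t₀ + L) ^ 2 + z (t₀ + L) ^ 2 + w ^ 2 < 1 := by
  obtain ⟨hp, ha, hz, hw⟩ := h.bounds_of_small_derivs hu ht₀ hδL hL hLμ h1 h2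
  have hy := h0 (t₀ + L) ⟨by linarith, le_rfl⟩
  have e1 := pow_le_pow_left₀ (norm_nonneg _) hp 2
  have e2 := pow_le_pow_left₀ (norm_nonneg _) ha 2
  have e3 := pow_le_pow_left₀ (abs_nonneg _) hz 2
  have e4 := pow_le_pow_left₀ (abs_nonneg _) hw 2
  have e5 := pow_le_pow_left₀ (abs_nonneg _) hy 2
  rw [sq_abs] at e3 e4 e5
  nlinarith

/-- The output and its first three derivatives along a free trajectory with final state of norm
at most one are bounded in terms of the input bounds and the window length. -/
theorem deriv_bounds (h : IsFreeTrajectory u t₀ L p a y z w)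
    (hu : IsExcitingInput u u₁ u₂ U U₁ U₂ δ μ) (ht₀ : 0 ≤ t₀) (hL : 0 ≤ L)
    (hp : ‖p (t₀ + L)‖ ≤ 1) (ha : ‖a‖ ≤ 1) (hz : |z (t₀ + L)| ≤ 1) (hw : |w| ≤ 1) {t : ℝ}
    (ht : t ∈ Icc t₀ (t₀ + L)) :
    |⟪u t, p t⟫ + z t| ≤ U * (1 + L) + 1 + (U + 1) * L ∧
      |⟪u₁ t, p t⟫ + 2 * ⟪u t, a⟫ + w| ≤ U₁ * (1 + L) + 2 * U + 1 ∧
      |⟪u₂ t, p t⟫ + 3 * ⟪u₁ t, a⟫| ≤ U₂ * (1 + L) + 3 * U₁ := by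
  have hsub : Icc t₀ (t₀ + L) ⊆ Ici (0 : ℝ) := fun s hs => ht₀.trans hs.1
  have hm1 : t₀ + L ∈ Icc t₀ (t₀ + L) := ⟨by linarith, le_rfl⟩
  have hU : 0 ≤ U := (norm_nonneg _).trans (hu.le_U 0 self_mem_Ici)
  have htL : ‖t - (t₀ + L)‖ ≤ L := by
    rw [Real.norm_eq_abs, abs_le]; constructor <;> linarith [ht.1, ht.2]
  have hpt : ‖p t‖ ≤ 1 + L := by
    have h1 := h.p_sub_eq hm1 ht
    have h2 : ‖p t - p (t₀ + L)‖ ≤ L * 1 := by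
      rw [h1, norm_smul]; gcongr
    have h3 := norm_sub_norm_le (p t) (p (t₀ + L))
    linarith
  have hua : ∀ s ∈ Icc t₀ (t₀ + L), |⟪u s, a⟫| ≤ U * 1 := fun s hs =>
    abs_inner_le_of_le (hu.le_U s (hsub hs)) ha
  have hzt : |z t| ≤ 1 + (U + 1) * L := by
    have h1 := (convex_Icc t₀ (t₀ + L)).norm_image_sub_le_of_norm_hasDerivWithin_le
      (fun s hs => h.deriv_z s hs) (C := U + 1) (fun s hs => by
        have := hua s hs
        exact (abs_add_le _ _).trans (by linarith)) hm1 ht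
    rw [Real.norm_eq_abs] at h1
    have h2 := abs_sub_abs_le_abs_sub (z t) (z (t₀ + L))
    have h3 : (U + 1) * ‖t - (t₀ + L)‖ ≤ (U + 1) * L := by gcongr
    linarith
  have e0 := abs_le.1 (hua t ht)
  have e1 := abs_le.1 (abs_inner_le_of_le (hu.le_U t (hsub ht)) hpt)
  have e2 := abs_le.1 (abs_inner_le_of_le (hu.le_U₁ t (hsub ht)) hpt)
  have e3 := abs_le.1 (abs_inner_le_of_le (hu.le_U₂ t (hsub ht)) hpt)
  have e4 := abs_le.1 (abs_inner_le_of_le (hu.le_U₁ t (hsub ht)) ha)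
  have e5 := abs_le.1 hzt
  have e6 := abs_le.1 hw
  refine ⟨abs_le.2 ⟨?_, ?_⟩, abs_le.2 ⟨?_, ?_⟩, abs_le.2 ⟨?_, ?_⟩⟩ <;> linarith

end IsFreeTrajectory

/-- Free trajectories are uniformly observable from `y` when the input is exciting: normalizing
the final state, a small output would have small first and second derivatives. -/
theorem IsExcitingInput.exists_observability (hu : IsExcitingInput u u₁ u₂ U U₁ U₂ δ μ) :
    ∃ L κ : ℝ, 0 < L ∧ 0 < κ ∧ ∀ (t₀ : ℝ) (p : ℝ → H) (a : H) (y z : ℝ → ℝ) (w : ℝ)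
      (Φ Φ' : ℝ → ℝ), 0 ≤ t₀ → IsFreeTrajectory u t₀ L p a y z w →
      (∀ t ∈ Icc t₀ (t₀ + L), HasDerivWithinAt Φ (Φ' t) (Icc t₀ (t₀ + L)) t) →
      (∀ t ∈ Icc t₀ (t₀ + L), y t ^ 2 ≤ Φ' t) →
      κ * (‖p (t₀ + L)‖ ^ 2 + ‖a‖ ^ 2 + y (t₀ + L) ^ 2 + z (t₀ + L) ^ 2 + w ^ 2)
        ≤ Φ (t₀ + L) - Φ t₀ := by
  have hU : 0 ≤ U := (norm_nonneg _).trans (hu.le_U 0 self_mem_Ici)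
  have hU₁ : 0 ≤ U₁ := (norm_nonneg _).trans (hu.le_U₁ 0 self_mem_Ici)
  have hU₂ : 0 ≤ U₂ := (norm_nonneg _).trans (hu.le_U₂ 0 self_mem_Ici)
  have hδ := hu.pos_δ
  have hμ : 0 < √μ := Real.sqrt_pos.2 hu.pos_μ
  set L : ℝ := δ + 1 + (4 * U + 2 * (2 * U + U₁ * δ) + 1) / √μ with hLdef
  have hfrac : 0 ≤ (4 * U + 2 * (2 * U + U₁ * δ) + 1) / √μ := by positivity
  have hL1 : 1 ≤ L := by linarith
  have hδL : δ ≤ L := by linarith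
  have hL0 : 0 < L := by linarith
  have hLμ : 4 * U + 2 * (2 * U + U₁ * δ) + 1 ≤ L * √μ := by
    rw [← div_le_iff₀ hμ]; linarith
  set B : ℝ := (2 + L) ^ 2 + (2 * (2 + L)) ^ 2 + 1 + (1 + U * (2 + L)) ^ 2
      + (2 + 4 * (U * (2 + L))) ^ 2 with hB
  have hB0 : 0 ≤ B := by positivity
  obtain ⟨ε, hε, hεB⟩ : ∃ ε : ℝ, 0 < ε ∧ ε ^ 2 * B < 1 := by
    refine ⟨1 / (B + 1), by positivity, ?_⟩
    rw [div_pow, div_mul_eq_mul_div, div_lt_one (by positivity)]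
    nlinarith
  obtain ⟨η₂, hη₂, hstep₂⟩ := exists_abs_deriv_le hL0
    (by positivity : 0 ≤ U₂ * (1 + L) + 3 * U₁) hε
  obtain ⟨η₁, hη₁, hstep₁⟩ := exists_abs_deriv_le hL0
    (by positivity : 0 ≤ U₁ * (1 + L) + 2 * U + 1) (lt_min hε hη₂)
  obtain ⟨κ, hκ, hstep₀⟩ := exists_abs_le_of_energy hL0
    (by positivity : 0 ≤ U * (1 + L) + 1 + (U + 1) * L) (lt_min hε hη₁)
  have hnorm : ∀ (t₀ : ℝ) (p : ℝ → H) (a : H) (y z : ℝ → ℝ) (w : ℝ)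
      (Φ Φ' : ℝ → ℝ), 0 ≤ t₀ → IsFreeTrajectory u t₀ L p a y z w →
      (∀ t ∈ Icc t₀ (t₀ + L), HasDerivWithinAt Φ (Φ' t) (Icc t₀ (t₀ + L)) t) →
      (∀ t ∈ Icc t₀ (t₀ + L), y t ^ 2 ≤ Φ' t) →
      ‖p (t₀ + L)‖ ^ 2 + ‖a‖ ^ 2 + y (t₀ + L) ^ 2 + z (t₀ + L) ^ 2 + w ^ 2 = 1 →
      κ ≤ Φ (t₀ + L) - Φ t₀ := by
    intro t₀ p a y z w Φ Φ' ht₀ h hΦ hle hone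
    by_contra! hlt
    have s1 := sq_nonneg ‖p (t₀ + L)‖
    have s2 := sq_nonneg ‖a‖
    have s3 := sq_nonneg (y (t₀ + L))
    have s4 := sq_nonneg (z (t₀ + L))
    have s5 := sq_nonneg w
    have hbd := fun t ht => h.deriv_bounds hu ht₀ hL0.le
      ((sq_le_one_iff₀ (norm_nonneg _)).1 (by linarith))
      ((sq_le_one_iff₀ (norm_nonneg _)).1 (by linarith))
      ((sq_le_one_iff_abs_le_one _).1 (by linarith))
      ((sq_le_one_iff_abs_le_one _).1 (by linarith)) (t := t) ht
    have h0 := hstep₀ t₀ y _ Φ Φ' h.deriv_y hΦ (fun t ht => (hbd t ht).1) hle hlt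
    have h1 := hstep₁ t₀ y _ _ h.deriv_y (fun t ht => h.hasDerivWithinAt_fst hu ht₀ ht)
      (fun t ht => (hbd t ht).2.1) (fun t ht => (h0 t ht).trans (min_le_right _ _))
    have h2 := hstep₂ t₀ _ _ _ (fun t ht => h.hasDerivWithinAt_fst hu ht₀ ht)
      (fun t ht => h.hasDerivWithinAt_snd hu ht₀ ht)
      (fun t ht => (hbd t ht).2.2) (fun t ht => (h1 t ht).trans (min_le_right _ _))
    have := h.sq_norm_lt_one hu ht₀ hδL hL1 hLμ hεB
      (fun t ht => (h0 t ht).trans (min_le_left _ _))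
      (fun t ht => (h1 t ht).trans (min_le_left _ _)) h2
    linarith
  refine ⟨L, κ, hL0, hκ, fun t₀ p a y z w Φ Φ' ht₀ h hΦ hle => ?_⟩
  set N : ℝ := ‖p (t₀ + L)‖ ^ 2 + ‖a‖ ^ 2 + y (t₀ + L) ^ 2 + z (t₀ + L) ^ 2 + w ^ 2 with hN
  have hN0 : 0 ≤ N := by positivity
  rcases hN0.eq_or_lt with h0 | h0
  · rw [← h0, mul_zero, sub_nonneg]
    exact le_of_hasDerivWithinAt_nonneg (by linarith) hΦ
      (fun t ht => (sq_nonneg _).trans (hle t ht))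
  · have hr : (√N)⁻¹ ^ 2 = N⁻¹ := by rw [inv_pow, Real.sq_sqrt hN0]
    have := hnorm t₀ _ _ _ _ _ (fun t => (√N)⁻¹ ^ 2 * Φ t) (fun t => (√N)⁻¹ ^ 2 * Φ' t) ht₀
      (h.smul (√N)⁻¹) (fun t ht => (hΦ t ht).const_mul _)
      (fun t ht => by rw [mul_pow]; gcongr; exact hle t ht) (by
        simp only [norm_smul, mul_pow, Real.norm_eq_abs, sq_abs, hr]
        rw [← mul_add, ← mul_add, ← mul_add, ← mul_add, ← hN, inv_mul_cancel₀ h0.ne'])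
    rw [hr, ← mul_sub, inv_mul_eq_div, le_div_iff₀ h0] at this
    exact this

end FreeObservability

section Perturbation

open Set
open scoped NNReal RealInnerProductSpace

variable {E : Type*} [NormedAddCommGroup E] [InnerProductSpace ℝ E]

/-- The difference between a perturbed and an unperturbed trajectory with the same initial state
is controlled by the energy of the perturbation. -/
theorem sq_norm_le_exp_mul {A : ℝ → E →L[ℝ] E} {x g : ℝ → E} {Φ Φ' : ℝ → ℝ} {t₀ T β : ℝ}
    (hβ : ∀ t ∈ Icc t₀ T, ‖A t‖ ≤ β) (h0 : x t₀ = 0)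
    (hx : ∀ t ∈ Icc t₀ T, HasDerivWithinAt x (A t (x t) + g t) (Icc t₀ T) t)
    (hΦ : ∀ t ∈ Icc t₀ T, HasDerivWithinAt Φ (Φ' t) (Icc t₀ T) t)
    (hle : ∀ t ∈ Icc t₀ T, ‖g t‖ ^ 2 ≤ Φ' t) {t : ℝ} (ht : t ∈ Icc t₀ T) :
    ‖x t‖ ^ 2 ≤ Real.exp ((2 * β + 1) * (T - t₀)) * (Φ T - Φ t₀) := by
  have hβ0 : 0 ≤ β := (norm_nonneg _).trans (hβ t ht)
  have hmono : ∀ r ∈ Icc t₀ T, ∀ s ∈ Icc t₀ T, r ≤ s → Φ r ≤ Φ s := fun r hr s hs hrs => by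
    have hsub : Icc r s ⊆ Icc t₀ T := Icc_subset_Icc hr.1 hs.2
    exact le_of_hasDerivWithinAt_nonneg hrs (fun t ht => (hΦ t (hsub ht)).mono hsub)
      (fun t ht => (sq_nonneg _).trans (hle t (hsub ht)))
  have hsub : Icc t₀ t ⊆ Icc t₀ T := Icc_subset_Icc_right ht.2
  have key := le_of_hasDerivWithinAt_nonneg ht.1
    (f := fun r => Φ r - Real.exp (-((2 * β + 1) * (r - t₀))) * ‖x r‖ ^ 2)
    (fun r hr => ((hΦ r (hsub hr)).mono hsub).sub
      (((((hasDerivWithinAt_id r _).sub_const t₀).const_mul (2 * β + 1)).neg.exp).mul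
        ((hx r (hsub hr)).mono hsub).norm_sq)) (fun r hr => by
      have h1 : ⟪x r, A r (x r) + g r⟫ ≤ β * ‖x r‖ ^ 2 + ‖x r‖ * ‖g r‖ := by
        rw [inner_add_right]
        refine add_le_add ((real_inner_le_norm _ _).trans ?_) (real_inner_le_norm _ _)
        calc ‖x r‖ * ‖A r (x r)‖ ≤ ‖x r‖ * (β * ‖x r‖) := by
              gcongr; exact (A r).le_of_opNorm_le (hβ r (hsub hr)) _
          _ = _ := by ring
      have h2 : 2 * ⟪x r, A r (x r) + g r⟫ - (2 * β + 1) * ‖x r‖ ^ 2 ≤ ‖g r‖ ^ 2 := by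
        nlinarith [sq_nonneg (‖x r‖ - ‖g r‖)]
      have h3 : Real.exp (-((2 * β + 1) * (r - t₀))) ≤ 1 := by
        rw [Real.exp_le_one_iff, neg_nonpos]
        exact mul_nonneg (by positivity) (by linarith [hr.1])
      have h4 := Real.exp_pos (-((2 * β + 1) * (r - t₀)))
      have h5 := hle r (hsub hr)
      have h6 := mul_le_mul_of_nonneg_left h2 h4.le
      have h7 := mul_le_mul_of_nonneg_right h3 (sq_nonneg ‖g r‖)
      simp only [id, Pi.neg_apply]
      linarith)
  simp only [h0, norm_zero] at key
  have hkey : Real.exp (-((2 * β + 1) * (t - t₀))) * ‖x t‖ ^ 2 ≤ Φ T - Φ t₀ := by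
    have := hmono t ht T ⟨ht.1.trans ht.2, le_rfl⟩ ht.2
    norm_num at key
    linarith
  have hge : Real.exp (-((2 * β + 1) * (T - t₀))) * ‖x t‖ ^ 2 ≤ Φ T - Φ t₀ := by
    refine le_trans ?_ hkey
    gcongr
    exact ht.2
  calc ‖x t‖ ^ 2 = Real.exp ((2 * β + 1) * (T - t₀))
        * (Real.exp (-((2 * β + 1) * (T - t₀))) * ‖x t‖ ^ 2) := by
        rw [← mul_assoc, ← Real.exp_add, add_neg_cancel, Real.exp_zero, one_mul]
    _ ≤ _ := by gcongr

/-- It suffices to test uniform observability on unperturbed trajectories. -/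
theorem isUniformlyObservable_of_free [FiniteDimensional ℝ E] {A : ℝ → E →L[ℝ] E} {c : E}
    {β L κ : ℝ} (hA : ContinuousOn A (Ici 0)) (hβ : ∀ t, 0 ≤ t → ‖A t‖ ≤ β) (hL : 0 < L)
    (hκ : 0 < κ)
    (hfree : ∀ (t₀ : ℝ) (x : ℝ → E) (Φ Φ' : ℝ → ℝ), 0 ≤ t₀ →
      (∀ t ∈ Icc t₀ (t₀ + L), HasDerivWithinAt x (A t (x t)) (Icc t₀ (t₀ + L)) t) →
      (∀ t ∈ Icc t₀ (t₀ + L), HasDerivWithinAt Φ (Φ' t) (Icc t₀ (t₀ + L)) t) →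
      (∀ t ∈ Icc t₀ (t₀ + L), ⟪c, x t⟫ ^ 2 ≤ Φ' t) →
      κ * ‖x (t₀ + L)‖ ^ 2 ≤ Φ (t₀ + L) - Φ t₀) :
    IsUniformlyObservable A c := by
  set G : ℝ := Real.exp ((2 * β + 1) * L) with hG
  have hG0 : 0 < G := Real.exp_pos _
  refine ⟨L, 2 / κ * (2 + 2 * ‖c‖ ^ 2 * G * L) + 2 * G, hL, by positivity,
    fun t₀ x g Φ Φ' ht₀ hx hΦ hle => ?_⟩
  have hsub : Icc t₀ (t₀ + L) ⊆ Ici (0 : ℝ) := fun s hs => ht₀.trans hs.1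
  obtain ⟨xf, hxf0, hxf⟩ := exists_solution_Ici (f := fun t x => A t x) (t₀ := t₀)
    (fun x => (hA.mono (Ici_subset_Ici.2 ht₀)).clm_apply continuousOn_const)
    (fun T => ⟨β.toNNReal, fun t ht => (A t).lipschitz.weaken (by
      rw [← NNReal.coe_le_coe, Real.coe_toNNReal _ ((norm_nonneg _).trans (hβ 0 le_rfl))]
      exact hβ t (ht₀.trans ht.1))⟩) (x t₀)
  have hxf' : ∀ t ∈ Icc t₀ (t₀ + L), HasDerivWithinAt xf (A t (xf t)) (Icc t₀ (t₀ + L)) t :=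
    fun t ht => (hxf t ht.1).mono Icc_subset_Ici_self
  have hD : ∀ t ∈ Icc t₀ (t₀ + L), ‖x t - xf t‖ ^ 2 ≤ G * (Φ (t₀ + L) - Φ t₀) :=
    fun t ht => by
      have := sq_norm_le_exp_mul (x := fun t => x t - xf t) (g := g)
        (fun t ht => hβ t (hsub ht)) (by rw [hxf0, sub_self])
        (fun t ht => ((hx t ht).sub (hxf' t ht)).congr_deriv (by rw [map_sub]; abel)) hΦ
        (fun t ht => (le_add_of_nonneg_left (sq_nonneg _)).trans (hle t ht)) ht
      rwa [add_sub_cancel_left] at this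
  set ΔΦ : ℝ := Φ (t₀ + L) - Φ t₀ with hΔ
  have hfin := hfree t₀ xf (fun t => 2 * Φ t + 2 * (‖c‖ ^ 2 * (G * ΔΦ)) * t)
    (fun t => 2 * Φ' t + 2 * (‖c‖ ^ 2 * (G * ΔΦ)) * 1) ht₀ hxf'
    (fun t ht => ((hΦ t ht).const_mul 2).add ((hasDerivWithinAt_id t _).const_mul _))
    (fun t ht => by
      have h1 : ⟪c, xf t⟫ = ⟪c, x t⟫ - ⟪c, x t - xf t⟫ := by rw [inner_sub_right]; ring
      have h2 : ⟪c, x t - xf t⟫ ^ 2 ≤ ‖c‖ ^ 2 * (G * ΔΦ) := by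
        calc ⟪c, x t - xf t⟫ ^ 2 = |⟪c, x t - xf t⟫| ^ 2 := (sq_abs _).symm
          _ ≤ (‖c‖ * ‖x t - xf t‖) ^ 2 :=
            pow_le_pow_left₀ (abs_nonneg _) (abs_real_inner_le_norm _ _) 2
          _ = ‖c‖ ^ 2 * ‖x t - xf t‖ ^ 2 := mul_pow _ _ _
          _ ≤ _ := by gcongr; exact hD t ht
      have h3 := hle t ht
      rw [h1]
      nlinarith [sq_nonneg (⟪c, x t⟫ + ⟪c, x t - xf t⟫), sq_nonneg ‖g t‖])
  have hfin' : ‖xf (t₀ + L)‖ ^ 2 ≤ 1 / κ * ((2 + 2 * ‖c‖ ^ 2 * G * L) * ΔΦ) := by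
    rw [one_div, inv_mul_eq_div, le_div_iff₀ hκ]
    refine le_trans (le_of_eq (mul_comm _ _)) (hfin.trans (le_of_eq ?_))
    rw [hΔ]; ring
  have hT := hD (t₀ + L) ⟨by linarith, le_rfl⟩
  have hsum : ‖x (t₀ + L)‖ ≤ ‖xf (t₀ + L)‖ + ‖x (t₀ + L) - xf (t₀ + L)‖ := by
    have := norm_add_le (xf (t₀ + L)) (x (t₀ + L) - xf (t₀ + L))
    rwa [add_sub_cancel] at this
  have hsq : ‖x (t₀ + L)‖ ^ 2
      ≤ 2 * ‖xf (t₀ + L)‖ ^ 2 + 2 * ‖x (t₀ + L) - xf (t₀ + L)‖ ^ 2 := by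
    have := pow_le_pow_left₀ (norm_nonneg _) hsum 2
    nlinarith [sq_nonneg (‖xf (t₀ + L)‖ - ‖x (t₀ + L) - xf (t₀ + L)‖)]
  calc ‖x (t₀ + L)‖ ^ 2
      ≤ 2 * (1 / κ * ((2 + 2 * ‖c‖ ^ 2 * G * L) * ΔΦ)) + 2 * (G * ΔΦ) := by linarith
    _ = _ := by ring

end Perturbation

end RangeObserver

/-! ### Matrices as operators on the extended state space -/

namespace RangeObserver

section Operators

open Set ContinuousLinearMap InnerProductSpace
open scoped NNReal RealInnerProductSpace

theorem hasDerivWithinAt_euclidean {ι : Type*} [Fintype ι] {f : ℝ → EuclideanSpace ℝ ι}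
    {f' : EuclideanSpace ℝ ι} {s : Set ℝ} {t : ℝ} :
    HasDerivWithinAt f f' s t ↔ ∀ i, HasDerivWithinAt (fun r => f r i) (f' i) s t := by
  simp only [hasDerivWithinAt_iff_hasFDerivWithinAt, hasFDerivWithinAt_euclidean]
  refine forall_congr' fun i => ?_
  rw [show PiLp.proj 2 (fun _ => ℝ) i ∘L toSpanSingleton ℝ f' = toSpanSingleton ℝ (f' i) by
    ext; simp]

variable {n : ℕ}

/-- The operator on the extended state space defined by a matrix. -/
noncomputable def toOp : Matrix (Idx n) (Idx n) ℝ ≃⋆ₐ[ℝ] (State n →L[ℝ] State n) :=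
  Matrix.toEuclideanCLM (n := Idx n) (𝕜 := ℝ)

theorem ofLp_toOp (M : Matrix (Idx n) (Idx n) ℝ) (x : State n) :
    (toOp M x).ofLp = M *ᵥ x.ofLp := rfl

theorem inner_toOp (M : Matrix (Idx n) (Idx n) ℝ) (x y : State n) :
    ⟪x, toOp M y⟫ = x.ofLp ⬝ᵥ M *ᵥ y.ofLp := Matrix.inner_toEuclideanCLM M x y

theorem toOp_injective :
    Function.Injective (toOp : Matrix (Idx n) (Idx n) ℝ → State n →L[ℝ] State n) :=
  (toOp (n := n)).injective

theorem toOp_eq_sum (M : Matrix (Idx n) (Idx n) ℝ) :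
    toOp M = ∑ i, ∑ j, M i j • toOp (Matrix.single i j (1 : ℝ)) := by
  conv_lhs => rw [Matrix.matrix_eq_sum_single M]
  simp only [map_sum]
  refine Finset.sum_congr rfl fun i _ => Finset.sum_congr rfl fun j _ => ?_
  rw [← map_smul, Matrix.smul_single, smul_eq_mul, mul_one]

theorem hasDerivWithinAt_toOp_iff {P : ℝ → Matrix (Idx n) (Idx n) ℝ}
    {P' : Matrix (Idx n) (Idx n) ℝ} {s : Set ℝ} {t : ℝ} :
    HasDerivWithinAt (fun r => toOp (P r)) (toOp P') s t
      ↔ ∀ i j, HasDerivWithinAt (fun r => P r i j) (P' i j) s t := by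
  constructor
  · intro h i j
    let l : (State n →L[ℝ] State n) →ₗ[ℝ] ℝ :=
      Matrix.entryLinearMap ℝ ℝ i j ∘ₗ (toOp (n := n)).symm.toAlgEquiv.toLinearMap
    have h1 := l.toContinuousLinearMap.hasFDerivAt.comp_hasDerivWithinAt t h
    have hl : ∀ M, l.toContinuousLinearMap (toOp M) = M i j := fun M =>
      congrFun₂ ((toOp (n := n)).symm_apply_apply M) i j
    rw [hl] at h1
    exact h1.congr (fun r _ => (hl (P r)).symm) (hl (P t)).symm
  · intro h
    have h1 : HasDerivWithinAt
        (fun r => ∑ i, ∑ j, P r i j • toOp (Matrix.single i j (1 : ℝ)))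
        (∑ i, ∑ j, P' i j • toOp (Matrix.single i j (1 : ℝ))) s t :=
      HasDerivWithinAt.fun_sum fun i _ => HasDerivWithinAt.fun_sum fun j _ => 
      (h i j).smul_const (toOp (Matrix.single i j (1 : ℝ)))
    simpa only [← toOp_eq_sum] using h1

theorem continuous_toOp : Continuous (toOp : Matrix (Idx n) (Idx n) ℝ → State n →L[ℝ] State n) := by
  rw [show (toOp : Matrix (Idx n) (Idx n) ℝ → State n →L[ℝ] State n) = _ from
    funext toOp_eq_sum]
  fun_prop

/-- An entrywise bound on matrices gives a bound on operator norms. -/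
theorem norm_toOp_le {M : Matrix (Idx n) (Idx n) ℝ} {b : ℝ} (hM : ∀ i j, |M i j| ≤ b) :
    ‖toOp M‖ ≤ b * ∑ i, ∑ j, ‖toOp (Matrix.single (i : Idx n) (j : Idx n) (1 : ℝ))‖ := by
  rw [toOp_eq_sum M, Finset.mul_sum]
  refine norm_sum_le_of_le _ fun i _ => ?_
  rw [Finset.mul_sum]
  refine norm_sum_le_of_le _ fun j _ => ?_
  rw [norm_smul]
  gcongr
  exact hM i j

/-- The vector `c` with `C x = ⟨c, x⟩`. -/
noncomputable def outputVec (n : ℕ) : State n := EuclideanSpace.single (Sum.inr 0) 1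

theorem inner_outputVec (x : State n) : ⟪outputVec n, x⟫ = x (Sum.inr 0) := by
  simp [outputVec, EuclideanSpace.inner_single_left]

theorem C_mulVec (x : Idx n → ℝ) : C n *ᵥ x = ![x (Sum.inr 0)] := by
  ext i
  simp [C, Matrix.mulVec, dotProduct, Fin.sum_univ_three,
    Fintype.sum_sum_type]

theorem transpose_C_mulVec (r : ℝ) : (C n)ᵀ *ᵥ ![r] = (r • outputVec n).ofLp := by
  ext i
  rcases i with i | i
  · simp [C, outputVec, Matrix.mulVec, dotProduct]
  · fin_cases i <;> simp [C, outputVec, Matrix.mulVec, dotProduct]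

theorem toOp_transpose_C_mul_C : toOp ((C n)ᵀ * C n) = rankOne ℝ (outputVec n) (outputVec n) := by
  ext1 x
  refine WithLp.ofLp_injective 2 ?_
  rw [ofLp_toOp, ← Matrix.mulVec_mulVec, C_mulVec, transpose_C_mulVec, rankOne_apply,
    inner_outputVec]

theorem toOp_transpose (M : Matrix (Idx n) (Idx n) ℝ) : toOp Mᵀ = adjoint (toOp M) := by
  have := map_star (toOp (n := n)) M
  rwa [Matrix.star_eq_conjTranspose, Matrix.conjTranspose_eq_transpose_of_trivial,
    star_eq_adjoint] at this

theorem toOp_riccatiRHS (v : Vec n) (q : ℝ) (V P : Matrix (Idx n) (Idx n) ℝ) :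
    toOp (riccatiRHS v q V P) = toOp (A v) * toOp P + toOp P * adjoint (toOp (A v))
      - toOp P * (q • rankOne ℝ (outputVec n) (outputVec n)) * toOp P + toOp V := by
  have h : q • (P * (C n)ᵀ * C n * P) = P * (q • ((C n)ᵀ * C n)) * P := by
    simp [Matrix.mul_assoc]
  rw [riccatiRHS, h, map_add, map_sub, map_add, map_mul, map_mul, map_mul, map_mul,
    toOp_transpose, map_smul, toOp_transpose_C_mul_C]

theorem inner_toOp_comm {M : Matrix (Idx n) (Idx n) ℝ} (hM : M.IsHermitian) (x y : State n) :
    ⟪toOp M x, y⟫ = ⟪x, toOp M y⟫ := by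
  have h : Mᵀ = M := by rw [← Matrix.conjTranspose_eq_transpose_of_trivial]; exact hM
  conv_lhs => rw [← h, toOp_transpose, adjoint_inner_left]

theorem posDef_of_inner {M : Matrix (Idx n) (Idx n) ℝ}
    (hs : ∀ x y : State n, ⟪toOp M x, y⟫ = ⟪x, toOp M y⟫)
    (hp : ∀ x : State n, x ≠ 0 → 0 < ⟪toOp M x, x⟫) : M.PosDef := by
  refine Matrix.PosDef.of_dotProduct_mulVec_pos ?_ fun x hx => ?_
  · have h : adjoint (toOp M) = toOp M := by
      ext1 x
      exact ext_inner_right ℝ fun y => by rw [adjoint_inner_left, hs]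
    rw [← toOp_transpose] at h
    rw [Matrix.IsHermitian, Matrix.conjTranspose_eq_transpose_of_trivial]
    exact toOp_injective h
  · have h := hp (WithLp.toLp 2 x) (by simpa using hx)
    rw [real_inner_comm, inner_toOp] at h
    simpa using h

/-- A positive definite matrix is bounded below by a positive multiple of the identity. -/
theorem exists_le_inner_of_posDef {M : Matrix (Idx n) (Idx n) ℝ} (hM : M.PosDef) :
    ∃ m, 0 < m ∧ ∀ x : State n, m * ‖x‖ ^ 2 ≤ ⟪toOp M x, x⟫ := by
  have hpos : ∀ x : State n, x ≠ 0 → 0 < ⟪toOp M x, x⟫ := fun x hx => by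
    rw [real_inner_comm, inner_toOp]
    simpa using hM.dotProduct_mulVec_pos (x := x.ofLp) (by simpa using hx)
  have hne : (Metric.sphere (0 : State n) 1).Nonempty := ⟨outputVec n, by simp [outputVec]⟩
  obtain ⟨x₀, hx₀, hmin⟩ := (isCompact_sphere (0 : State n) 1).exists_isMinOn hne
    (f := fun x => ⟪toOp M x, x⟫) (by fun_prop)
  have hx₀' : x₀ ≠ 0 := by
    rintro rfl
    simp at hx₀
  refine ⟨⟪toOp M x₀, x₀⟫, hpos x₀ hx₀', fun x => ?_⟩
  rcases eq_or_ne x 0 with rfl | hx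
  · simp
  · have hnx : 0 < ‖x‖ := norm_pos_iff.2 hx
    have h1 := hmin (show ‖x‖⁻¹ • x ∈ Metric.sphere (0 : State n) 1 by
      simp [norm_smul, hnx.ne'])
    simp only [mem_ofPred_eq, map_smul, inner_smul_left, inner_smul_right, RCLike.conj_to_real]
      at h1
    rw [← mul_assoc, ← sq, inv_pow, inv_mul_eq_div, le_div_iff₀ (by positivity)] at h1
    exact h1

theorem le_inner_of_posSemidef {M : Matrix (Idx n) (Idx n) ℝ} {ε : ℝ}
    (hM : (M - ε • (1 : Matrix (Idx n) (Idx n) ℝ)).PosSemidef) (x : State n) :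
    ε * ‖x‖ ^ 2 ≤ ⟪toOp M x, x⟫ := by
  have h := hM.dotProduct_mulVec_nonneg x.ofLp
  rw [star_trivial, ← inner_toOp, map_sub, map_smul, map_one, sub_apply, inner_sub_right,
    smul_apply, one_apply_eq_self, inner_smul_right, real_inner_self_eq_norm_sq,
    real_inner_comm] at h
  linarith

theorem isHermitian_of_posSemidef_sub {M : Matrix (Idx n) (Idx n) ℝ} {ε : ℝ}
    (hM : (M - ε • (1 : Matrix (Idx n) (Idx n) ℝ)).PosSemidef) : M.IsHermitian := by
  have h := hM.1.add ((Matrix.isHermitian_one (n := Idx n) (α := ℝ)).smul (IsSelfAdjoint.all ε))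
  rwa [sub_add_cancel] at h

theorem A_mulVec_pos (v : Vec n) (x : Idx n → ℝ) (i : Fin n) :
    (A v *ᵥ x) (Sum.inl (Sum.inl i)) = x (Sum.inl (Sum.inr i)) := by
  simp [A, Matrix.mulVec, dotProduct, Fintype.sum_sum_type, Matrix.one_apply]

theorem A_mulVec_bias (v : Vec n) (x : Idx n → ℝ) (i : Fin n) :
    (A v *ᵥ x) (Sum.inl (Sum.inr i)) = 0 := by
  simp [A, Matrix.mulVec, dotProduct, Fintype.sum_sum_type]

theorem A_mulVec_zero (v : Vec n) (x : Idx n → ℝ) :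
    (A v *ᵥ x) (Sum.inr 0) = ∑ j, v j * x (Sum.inl (Sum.inl j)) + x (Sum.inr 1) := by
  simp [A, Matrix.mulVec, dotProduct, Fintype.sum_sum_type, Fin.sum_univ_three]

theorem A_mulVec_one (v : Vec n) (x : Idx n → ℝ) :
    (A v *ᵥ x) (Sum.inr 1) = ∑ j, v j * x (Sum.inl (Sum.inr j)) + x (Sum.inr 2) := by
  simp [A, Matrix.mulVec, dotProduct, Fintype.sum_sum_type, Fin.sum_univ_three]

theorem A_mulVec_two (v : Vec n) (x : Idx n → ℝ) : (A v *ᵥ x) (Sum.inr 2) = 0 := by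
  simp [A, Matrix.mulVec, dotProduct, Fintype.sum_sum_type, Fin.sum_univ_three]

theorem continuous_A : Continuous (A : Vec n → Matrix (Idx n) (Idx n) ℝ) := by
  refine continuous_matrix fun i j => ?_
  rcases i with (i | i) | i <;> rcases j with (j | j) | j <;>
    simp only [A, Matrix.fromBlocks_apply₁₁, Matrix.fromBlocks_apply₁₂,
      Matrix.fromBlocks_apply₂₁, Matrix.fromBlocks_apply₂₂] <;> try exact continuous_const
  all_goals fin_cases i <;> simp <;> fun_prop

theorem abs_A_apply_le (v : Vec n) (i j : Idx n) : |A v i j| ≤ ‖v‖ + 1 := by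
  have h := norm_nonneg v
  have hv : ∀ j, |v j| ≤ ‖v‖ + 1 := fun j => (PiLp.norm_apply_le v j).trans (by linarith)
  rcases i with (i | i) | i <;> rcases j with (j | j) | j <;>
    simp only [A, Matrix.fromBlocks_apply₁₁, Matrix.fromBlocks_apply₁₂,
      Matrix.fromBlocks_apply₂₁, Matrix.fromBlocks_apply₂₂, Matrix.zero_apply, abs_zero,
      Matrix.one_apply] <;> try positivity
  · split_ifs
    · simp
    · simpa using (by positivity : 0 ≤ ‖v‖ + 1)
  · fin_cases i <;> simp [hv] <;> positivity
  · fin_cases i <;> simp [hv] <;> positivity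
  · fin_cases i <;> fin_cases j <;> simp <;> positivity

end Operators

end RangeObserver

/-! ### The range observer -/

namespace RangeObserver

section Observer

open Set ContinuousLinearMap InnerProductSpace
open scoped NNReal RealInnerProductSpace

variable {n : ℕ}

theorem dotProduct_excitation_mulVec {f : ℝ → Vec n} {δ t : ℝ} (hδ : 0 ≤ δ)
    (hf : ContinuousOn f (Icc t (t + δ))) (p : Vec n) :
    p.ofLp ⬝ᵥ excitation f δ t *ᵥ p.ofLp = (1 / δ) * ∫ s in t..(t + δ), ⟪f s, p⟫ ^ 2 := by
  have hfi : ∀ i, ContinuousOn (fun s => f s i) (uIcc t (t + δ)) := fun i => by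
    rw [uIcc_of_le (by linarith)]
    exact (EuclideanSpace.proj (𝕜 := ℝ) i).continuous.comp_continuousOn hf
  have hcont : ∀ i j, ContinuousOn (fun s => p i * p j * (f s i * f s j)) (uIcc t (t + δ)) :=
    fun i j => continuousOn_const.mul ((hfi i).mul (hfi j))
  have hsq : ∀ s, ⟪f s, p⟫ ^ 2 = ∑ i, ∑ j, p i * p j * (f s i * f s j) := fun s => by
    rw [PiLp.inner_apply, sq, Finset.sum_mul_sum]
    refine Finset.sum_congr rfl fun i _ => Finset.sum_congr rfl fun j _ => ?_
    simp only [RCLike.inner_apply, conj_trivial]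
    ring
  simp only [hsq]
  rw [intervalIntegral.integral_finsetSum
    fun i _ => (continuousOn_finsetSum _ fun j _ => hcont i j).intervalIntegrable,
    Finset.mul_sum, dotProduct]
  refine Finset.sum_congr rfl fun i _ => ?_
  rw [intervalIntegral.integral_finsetSum fun j _ => (hcont i j).intervalIntegrable,
    Matrix.mulVec, dotProduct,
    Finset.mul_sum, Finset.mul_sum]
  refine Finset.sum_congr rfl fun j _ => ?_
  rw [intervalIntegral.integral_const_mul, excitation, Matrix.of_apply]
  ring

theorem PersistentlyExciting.sqrt_mul_norm_le {f : ℝ → Vec n} {δ μ : ℝ}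
    (h : PersistentlyExciting f δ μ) (hδ : 0 < δ) (hμ : 0 < μ) (hf : ContinuousOn f (Ici 0))
    {s : ℝ} (hs : 0 ≤ s) {p : Vec n} {R : ℝ} (hR : 0 ≤ R)
    (hle : ∀ t ∈ Icc s (s + δ), |⟪f t, p⟫| ≤ R) : √μ * ‖p‖ ≤ R := by
  have hf' : ContinuousOn f (Icc s (s + δ)) := hf.mono fun t ht => hs.trans ht.1
  have h1 := (h s hs).dotProduct_mulVec_nonneg p.ofLp
  rw [star_trivial, Matrix.sub_mulVec, Matrix.smul_mulVec, Matrix.one_mulVec, dotProduct_sub,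
    dotProduct_excitation_mulVec hδ.le hf', dotProduct_smul, smul_eq_mul] at h1
  have hpp : p.ofLp ⬝ᵥ p.ofLp = ‖p‖ ^ 2 := by
    rw [EuclideanSpace.norm_sq_eq, dotProduct]
    exact Finset.sum_congr rfl fun i _ => by rw [Real.norm_eq_abs, sq_abs, sq]
  have hint : ContinuousOn (fun t => ⟪f t, p⟫ ^ 2) (uIcc s (s + δ)) := by
    rw [uIcc_of_le (by linarith)]
    exact (hf'.inner continuousOn_const).pow 2
  have h2 : ∫ t in s..(s + δ), ⟪f t, p⟫ ^ 2 ≤ ∫ _ in s..(s + δ), R ^ 2 :=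
    intervalIntegral.integral_mono_on (by linarith) hint.intervalIntegrable
      intervalIntegrable_const fun t ht => by
        rw [← sq_abs]
        exact pow_le_pow_left₀ (abs_nonneg _) (hle t ht) 2
  rw [intervalIntegral.integral_const, add_sub_cancel_left, smul_eq_mul] at h2
  have h3 : 1 / δ * ∫ t in s..(s + δ), ⟪f t, p⟫ ^ 2 ≤ R ^ 2 := by
    rw [one_div, inv_mul_le_iff₀ hδ]
    exact h2
  refine (sq_le_sq₀ (by positivity) hR).1 ?_
  rw [mul_pow, Real.sq_sqrt hμ.le, ← hpp]
  linarith

/-- The homogeneous extended system is uniformly observable from `y`: on a window its bias component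
and its last component are constant, so that its solutions are free trajectories. -/
theorem isUniformlyObservable {u u₁ u₂ : ℝ → Vec n} {U U₁ U₂ δ μ : ℝ}
    (hu : IsExcitingInput u u₁ u₂ U U₁ U₂ δ μ) {β : ℝ}
    (hβ : ∀ t, 0 ≤ t → ‖toOp (A (u t))‖ ≤ β) :
    IsUniformlyObservable (fun t => toOp (A (u t))) (outputVec n) := by
  have huc : ContinuousOn u (Ici 0) := fun t ht => (hu.deriv t ht).continuousWithinAt
  obtain ⟨L, κ, hL, hκ, hobs⟩ := hu.exists_observability
  refine isUniformlyObservable_of_free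
    ((continuous_toOp.comp continuous_A).comp_continuousOn huc) hβ hL hκ
    fun t₀ x Φ Φ' ht₀ hx hΦ hle => ?_
  have hm0 : t₀ ∈ Icc t₀ (t₀ + L) := ⟨le_rfl, by linarith⟩
  have hm1 : t₀ + L ∈ Icc t₀ (t₀ + L) := ⟨by linarith, le_rfl⟩
  have hentry := fun t ht => hasDerivWithinAt_euclidean.1 (hx t ht)
  simp only [ofLp_toOp] at hentry
  have hconst : ∀ (f : ℝ → ℝ), (∀ t ∈ Icc t₀ (t₀ + L),
      HasDerivWithinAt f 0 (Icc t₀ (t₀ + L)) t) →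
      ∀ t ∈ Icc t₀ (t₀ + L), f t = f (t₀ + L) := fun f hf t ht => by
    have := (convex_Icc t₀ (t₀ + L)).norm_image_sub_le_of_norm_hasDerivWithin_le hf
      (C := 0) (by simp) hm1 ht
    rwa [zero_mul, norm_le_zero_iff, sub_eq_zero] at this
  have hbias : ∀ i, ∀ t ∈ Icc t₀ (t₀ + L),
      x t (Sum.inl (Sum.inr i)) = x (t₀ + L) (Sum.inl (Sum.inr i)) := fun i =>
    hconst _ fun t ht => by simpa only [A_mulVec_bias] using hentry t ht (Sum.inl (Sum.inr i))
  have hw : ∀ t ∈ Icc t₀ (t₀ + L), x t (Sum.inr 2) = x (t₀ + L) (Sum.inr 2) :=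
    hconst _ fun t ht => by simpa only [A_mulVec_two] using hentry t ht (Sum.inr 2)
  have hfree : IsFreeTrajectory u t₀ L (fun t => WithLp.toLp 2 fun j => x t (Sum.inl (Sum.inl j)))
      (WithLp.toLp 2 fun j => x (t₀ + L) (Sum.inl (Sum.inr j))) (fun t => x t (Sum.inr 0))
      (fun t => x t (Sum.inr 1)) (x (t₀ + L) (Sum.inr 2)) := by
    refine ⟨fun t ht => hasDerivWithinAt_euclidean.2 fun i => ?_, fun t ht => ?_, fun t ht => ?_⟩
    · have := hentry t ht (Sum.inl (Sum.inl i))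
      rw [A_mulVec_pos, hbias i t ht] at this
      exact this
    · have := hentry t ht (Sum.inr 0)
      rw [A_mulVec_zero] at this
      refine this.congr_deriv ?_
      simp [PiLp.inner_apply, mul_comm]
    · have := hentry t ht (Sum.inr 1)
      rw [A_mulVec_one, hw t ht] at this
      refine this.congr_deriv ?_
      simp [PiLp.inner_apply, mul_comm, fun i => hbias i t ht]
  have key := hobs t₀ _ _ _ _ _ Φ Φ' ht₀ hfree hΦ fun t ht => by
    have := hle t ht
    rwa [inner_outputVec] at this
  have hnorm : ‖x (t₀ + L)‖ ^ 2
      = ‖(WithLp.toLp 2 fun j => x (t₀ + L) (Sum.inl (Sum.inl j)) : Vec n)‖ ^ 2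
        + ‖(WithLp.toLp 2 fun j => x (t₀ + L) (Sum.inl (Sum.inr j)) : Vec n)‖ ^ 2
        + x (t₀ + L) (Sum.inr 0) ^ 2 + x (t₀ + L) (Sum.inr 1) ^ 2
        + x (t₀ + L) (Sum.inr 2) ^ 2 := by
    simp only [EuclideanSpace.norm_sq_eq, Fintype.sum_sum_type, Fin.sum_univ_three,
      Real.norm_eq_abs, sq_abs]
    ring
  rw [hnorm]
  exact key

/-- The extended state satisfies the linear extended system. -/
theorem hasDerivWithinAt_extState {u x : ℝ → Vec n} {a : Vec n} (hx : IsMotion u a x) {t : ℝ}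
    (ht : 0 ≤ t) :
    HasDerivWithinAt (fun s => extState (x s) a)
      (toOp (A (u t)) (extState (x t) a) + WithLp.toLp 2 (ubar (u t))) (Ici 0) t := by
  have hxt := hx t ht
  refine hasDerivWithinAt_euclidean.2 fun i => ?_
  simp only [PiLp.add_apply, ofLp_toOp]
  rcases i with (i | i) | i
  · rw [A_mulVec_pos]
    refine (hasDerivWithinAt_euclidean.1 hxt i).congr_deriv ?_
    simp [extState, ubar, add_comm]
  · rw [A_mulVec_bias]
    simpa [extState, ubar] using hasDerivWithinAt_const t (Ici (0 : ℝ)) (a i)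
  · fin_cases i
    · simp only [Fin.zero_eta, A_mulVec_zero]
      refine (hxt.norm_sq.div_const 2).congr_deriv ?_
      simp [extState, ubar, inner_add_right, PiLp.inner_apply, mul_add, mul_comm]
      ring
    · simp only [Fin.mk_one, A_mulVec_one]
      refine ((hasDerivWithinAt_const t _ a).inner ℝ hxt).congr_deriv ?_
      simp [extState, ubar, inner_add_right, PiLp.inner_apply, mul_comm]
    · simp only [Fin.reduceFinMk, A_mulVec_two]
      simpa [extState, ubar] using hasDerivWithinAt_const t (Ici (0 : ℝ)) (‖a‖ ^ 2)

theorem observer_rhs_eq (v : Vec n) (k q y : ℝ) (P : Matrix (Idx n) (Idx n) ℝ) (X : State n) :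
    (WithLp.toLp 2 (A v *ᵥ X.ofLp + ubar v + gain k q P *ᵥ (![y] - C n *ᵥ X.ofLp)) : State n)
      = toOp (A v) X + WithLp.toLp 2 (ubar v)
        + (k * q * (y - ⟪outputVec n, X⟫)) • toOp P (outputVec n) := by
  refine WithLp.ofLp_injective 2 ?_
  have h : ![y] - ![X (Sum.inr 0)] = ![y - X (Sum.inr 0)] := by ext i; fin_cases i; simp
  rw [C_mulVec, h, gain, Matrix.smul_mulVec, ← Matrix.mulVec_mulVec, transpose_C_mulVec,
    inner_outputVec, WithLp.ofLp_smul, Matrix.mulVec_smul, smul_smul]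
  rfl

/-- The observer has a solution for every initial estimate, its equation being affine. -/
theorem exists_observerRun {u : ℝ → Vec n} {k q y : ℝ → ℝ} {P : ℝ → Matrix (Idx n) (Idx n) ℝ}
    (hu : ContinuousOn u (Ici 0)) (hk : ContinuousOn k (Ici 0)) (hq : ContinuousOn q (Ici 0))
    (hy : ContinuousOn y (Ici 0)) (hP : ContinuousOn (fun t => toOp (P t)) (Ici 0))
    (X₀ : State n) : ∃ Xh : ℝ → State n, Xh 0 = X₀ ∧ IsObserverRun u k q P y Xh := by
  have hA : ContinuousOn (fun t => toOp (A (u t))) (Ici 0) :=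
    (continuous_toOp.comp continuous_A).comp_continuousOn hu
  have hPc : ContinuousOn (fun t => toOp (P t) (outputVec n)) (Ici 0) :=
    hP.clm_apply continuousOn_const
  have hub : ContinuousOn (fun t => (WithLp.toLp 2 (ubar (u t)) : State n)) (Ici 0) := by
    refine (PiLp.continuous_toLp 2 _).comp_continuousOn (continuousOn_pi.2 fun i => ?_)
    rcases i with (i | i) | i
    · exact (EuclideanSpace.proj (𝕜 := ℝ) i).continuous.comp_continuousOn hu
    · exact continuousOn_const
    · exact continuousOn_const
  -- The linear part of the observer equation.
  let B : ℝ → State n →L[ℝ] State n := fun t =>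
    toOp (A (u t)) - (k t * q t) • rankOne ℝ (toOp (P t) (outputVec n)) (outputVec n)
  have hB : ContinuousOn B (Ici 0) := by
    refine hA.sub ((hk.mul hq).smul ?_)
    exact (((rankOne ℝ).continuous.comp_continuousOn hPc)).clm_apply continuousOn_const
  obtain ⟨Xh, h0, hXh⟩ := exists_solution_Ici (t₀ := 0) (x₀ := X₀)
    (f := fun t X => B t X + (WithLp.toLp 2 (ubar (u t))
      + (k t * q t * y t) • toOp (P t) (outputVec n)))
    (fun X => (hB.clm_apply continuousOn_const).add
      (hub.add (((hk.mul hq).mul hy).smul hPc)))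
    (fun T => by
      obtain ⟨b, hb⟩ := isCompact_Icc.exists_bound_of_continuousOn
        (hB.mono (Icc_subset_Ici_self : Icc 0 T ⊆ Ici 0))
      refine ⟨b.toNNReal, fun t ht => LipschitzWith.of_dist_le_mul fun X X' => ?_⟩
      rw [dist_add_right, dist_eq_norm, dist_eq_norm, ← map_sub,
        Real.coe_toNNReal _ ((norm_nonneg _).trans (hb t ht))]
      exact (B t).le_of_opNorm_le (hb t ht) _)
  refine ⟨Xh, h0, fun t ht => (hXh t ht).congr_deriv ?_⟩
  rw [observer_rhs_eq]
  simp only [B, sub_apply, smul_apply, rankOne_apply, mul_sub, sub_smul, smul_smul]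
  abel

/-- The estimation error solves the homogeneous linear equation `ė = (A - k q P Cᵀ C) e`. -/
theorem IsObserverRun.hasDerivWithinAt_error {u x : ℝ → Vec n} {a : Vec n} {k q : ℝ → ℝ}
    {P : ℝ → Matrix (Idx n) (Idx n) ℝ} {Xh : ℝ → State n} (hx : IsMotion u a x)
    (hXh : IsObserverRun u k q P (fun t => output (x t)) Xh) {t : ℝ} (ht : 0 ≤ t) :
    HasDerivWithinAt (fun s => extState (x s) a - Xh s)
      (toOp (A (u t)) (extState (x t) a - Xh t)
        - (k t * q t * ⟪outputVec n, extState (x t) a - Xh t⟫) • toOp (P t) (outputVec n))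
      (Ici 0) t := by
  refine ((hasDerivWithinAt_extState hx ht).sub (hXh t ht)).congr_deriv ?_
  have hy : output (x t) = ⟪outputVec n, extState (x t) a⟫ := by
    rw [inner_outputVec]; rfl
  rw [observer_rhs_eq]
  simp only [hy, ← inner_sub_right, map_sub]
  abel

end Observer

end RangeObserver

theorem mainTheorem2 (n : ℕ) (_hn : 2 ≤ n)
    (u : ℝ → RangeObserver.Vec n)
    (_hu : DifferentiableOn ℝ u (Set.Ici 0))
    (_hu' : DifferentiableOn ℝ (RangeObserver.dot u) (Set.Ici 0))
    (_hub : ∃ c : ℝ, ∀ t, 0 ≤ t → ‖u t‖ ≤ c)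
    (_hub' : ∃ c : ℝ, ∀ t, 0 ≤ t → ‖RangeObserver.dot u t‖ ≤ c)
    (_hub'' : ∃ c : ℝ, ∀ t, 0 ≤ t → ‖RangeObserver.dot (RangeObserver.dot u) t‖ ≤ c)
    (δ μ : ℝ) (_hδ : 0 < δ) (_hμ : 0 < μ)
    (_hpe : RangeObserver.PersistentlyExciting (RangeObserver.dot u) δ μ)
    (k q : ℝ → ℝ) (V : ℝ → Matrix (RangeObserver.Idx n) (RangeObserver.Idx n) ℝ)
    (P₀ : Matrix (RangeObserver.Idx n) (RangeObserver.Idx n) ℝ)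
    (_hk : ContinuousOn k (Set.Ici 0)) (_hk' : ∀ t, 0 ≤ t → 1 / 2 ≤ k t)
    (ε : ℝ) (_hε : 0 < ε)
    (_hq : ContinuousOn q (Set.Ici 0)) (_hqb : ∃ c : ℝ, ∀ t, 0 ≤ t → q t ≤ c)
    (_hqε : ∀ t, 0 ≤ t → ε ≤ q t)
    (_hV : ContinuousOn V (Set.Ici 0))
    (_hVb : ∃ c : ℝ, ∀ t, 0 ≤ t → ∀ i j, |V t i j| ≤ c)
    (_hVε : ∀ t, 0 ≤ t →
      (V t - ε • (1 : Matrix (RangeObserver.Idx n) (RangeObserver.Idx n) ℝ)).PosSemidef)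
    (_hP₀ : P₀.PosDef) :
    ∃ P : ℝ → Matrix (RangeObserver.Idx n) (RangeObserver.Idx n) ℝ,
      RangeObserver.IsRiccatiSolution u q V P₀ P ∧
      (∀ P' : ℝ → Matrix (RangeObserver.Idx n) (RangeObserver.Idx n) ℝ,
        RangeObserver.IsRiccatiSolution u q V P₀ P' → ∀ t, 0 ≤ t → P' t = P t) ∧
      (∀ t, 0 ≤ t → (P t).PosDef) ∧
      (∀ (a : RangeObserver.Vec n) (x : ℝ → RangeObserver.Vec n), RangeObserver.IsMotion u a x →
        ∀ X₀ : RangeObserver.State n, ∃ Xh : ℝ → RangeObserver.State n, Xh 0 = X₀ ∧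
          RangeObserver.IsObserverRun u k q P (fun t => RangeObserver.output (x t)) Xh) ∧
      RangeObserver.GloballyExponentiallyStabilizes u k q P := by
  obtain ⟨U, hU⟩ := _hub
  obtain ⟨U₁, hU₁⟩ := _hub'
  obtain ⟨U₂, hU₂⟩ := _hub''
  obtain ⟨qm, hqm⟩ := _hqb
  obtain ⟨b, hb⟩ := _hVb
  obtain ⟨p₀, hp₀, hP₀⟩ := RangeObserver.exists_le_inner_of_posDef _hP₀
  have hP₀s := RangeObserver.inner_toOp_comm _hP₀.1
  have huc : ContinuousOn u (Set.Ici 0) := _hu.continuousOn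
  have hexc : RangeObserver.IsExcitingInput u (RangeObserver.dot u)
      (RangeObserver.dot (RangeObserver.dot u)) U U₁ U₂ δ μ :=
    { deriv := fun t ht => (_hu t ht).hasDerivWithinAt
      deriv_deriv := fun t ht => (_hu' t ht).hasDerivWithinAt
      le_U := hU
      le_U₁ := hU₁
      le_U₂ := hU₂
      pos_δ := _hδ
      pos_μ := _hμ
      excite := fun s hs p R hR hle =>
        _hpe.sqrt_mul_norm_le _hδ _hμ _hu'.continuousOn hs hR hle }
  have hβ := fun t (ht : 0 ≤ t) => RangeObserver.norm_toOp_le fun i j =>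
    (RangeObserver.abs_A_apply_le (u t) i j).trans (add_le_add_left (hU t ht) 1)
  have hv := fun t (ht : 0 ≤ t) => RangeObserver.norm_toOp_le (hb t ht)
  have hd : RangeObserver.IsRiccatiData (fun t => RangeObserver.toOp (RangeObserver.A (u t)))
      (fun t => RangeObserver.toOp (V t)) q ε :=
    { pos := _hε
      cont_A := (RangeObserver.continuous_toOp.comp
        RangeObserver.continuous_A).comp_continuousOn huc
      cont_V := RangeObserver.continuous_toOp.comp_continuousOn _hV
      cont_q := _hq
      le_q := _hqε
      symm_V := fun t ht => RangeObserver.inner_toOp_comm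
        (RangeObserver.isHermitian_of_posSemidef_sub (_hVε t ht))
      le_V := fun t ht => RangeObserver.le_inner_of_posSemidef (_hVε t ht) }
  obtain ⟨Y, Z, h⟩ := hd.exists_hamiltonianPair (RangeObserver.outputVec n)
    (RangeObserver.toOp P₀)
  have hZ := fun t (ht : 0 ≤ t) => h.isUnit_snd hd hp₀ hP₀ ht
  have hR := fun t (ht : 0 ≤ t) => h.hasDerivWithinAt_riccatiOf ht (hZ t ht)
  let P : ℝ → Matrix (RangeObserver.Idx n) (RangeObserver.Idx n) ℝ :=
    fun t => RangeObserver.toOp.symm (RangeObserver.riccatiOf Y Z t)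
  have hP : ∀ t, RangeObserver.toOp (P t) = RangeObserver.riccatiOf Y Z t := fun t =>
    RangeObserver.toOp.apply_symm_apply _
  refine ⟨P, ⟨?_, fun t ht => ?_⟩, fun P' hP' t ht => ?_, fun t ht => ?_, fun a x hx X₀ => ?_, ?_⟩
  · refine RangeObserver.toOp_injective ?_
    rw [hP, RangeObserver.riccatiOf, h.init_fst, h.init_snd, Ring.inverse_one, mul_one]
  · rw [← RangeObserver.hasDerivWithinAt_toOp_iff, RangeObserver.toOp_riccatiRHS]
    simp only [hP]
    exact hR t ht
  · refine RangeObserver.toOp_injective ?_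
    rw [hP]
    refine h.eq_riccatiOf hd (P := fun t => RangeObserver.toOp (P' t)) (by rw [hP'.1])
      (fun s hs => ?_) ht (hZ t ht)
    have := RangeObserver.hasDerivWithinAt_toOp_iff.2 (hP'.2 s hs)
    rwa [RangeObserver.toOp_riccatiRHS] at this
  · refine RangeObserver.posDef_of_inner (fun x y => ?_) fun x hx => ?_
    · rw [hP]
      exact h.inner_riccatiOf_comm hd hP₀s ht (hZ t ht) x y
    · rw [hP]
      exact h.inner_riccatiOf_pos hd hp₀ hP₀ ht hx
  · refine RangeObserver.exists_observerRun huc _hk _hq ?_ ?_ X₀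
    · have hxc : ContinuousOn x (Set.Ici 0) := fun t ht => (hx t ht).continuousWithinAt
      exact (hxc.norm.pow 2).div_const 2
    · simp only [hP]
      exact fun t ht => (hR t ht).continuousWithinAt
  · obtain ⟨c, γ, hc, hγ, hbound⟩ := h.exists_exponential_bound hd hp₀ hP₀ hP₀s
      (RangeObserver.isUniformlyObservable hexc hβ) hβ hv hqm _hk'
    refine ⟨c, γ, hc, hγ, fun a x hx Xh hXh => hbound _ fun t ht => ?_⟩
    rw [← hP]
    exact hXh.hasDerivWithinAt_error hx ht
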